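/- Manifolds are smooth and finite-dimensional, not necessarily Hausdorff. For a groupoid $G\rightrightarrows M$ with source $\mathtt s$ and target $\mathtt t$, a product $gh$ is defined when $\mathtt s(g)=\mathtt t(h)$, and the orbit of $x\in M$ is $\{\mathtt t(g):\mathtt s(g)=x\}$. A smooth groupoid is a groupoid whose arrows and objects form manifolds, whose structure maps are smooth and whose source map is a submersion; it is a Lie groupoid if its base and its source-fibres are Hausdorff. A double Lie groupoid $$\begin{array}{ccc} G_1&\rightrightarrows& M_1\\ \downdownarrows&&\downdownarrows\\ G_0&\rightrightarrows& M_0\end{array}$$ consists of smooth groupoids $G_1\rightrightarrows M_1$, $G_1\rightrightarrows G_0$ and Lie groupoids $M_1\rightrightarrows M_0$, $G_0\rightrightarrows M_0$ such that the structure maps of $G_1\rightrightarrows G_0$ over those of $M_1\rightrightarrows M_0$ are morphisms of groupoids between (the fibre product groupoid of composable pairs of, in the case of the multiplication) $G_1\rightrightarrows M_1$ and $G_0\rightrightarrows M_0$, and such that the double source map $(\mathtt s^{M_1},\mathtt s^{G_0}):G_1\to M_1\times_{M_0}G_0$ into the fibre product of the source maps $\mathtt s_{M_1}$, $\mathtt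 s_{G_0}$ is a submersion (superscripts denote the groupoid structures $G_1\rightrightarrows M_1$, $G_1\rightrightarrows G_0$). **Proposition 3.3.** Let $G_1$ be a double Lie groupoid with sides $M_1$ and $G_0$ over $M_0$. Let $u\in M_0$, let $\mathcal O\subset M_0$ be the $G_0$-orbit of $u$ and let $\mathcal O'\subset M_1$ be the $G_1$-orbit of the unit $1_u\in M_1$. Then $\mathcal O'$ is an immersed smooth subgroupoid of $M_1\rightrightarrows M_0$ over $\mathcal O$, that is: 1. $\mathcal O'$ is a subgroupoid of $M_1\rightrightarrows M_0$ over $\mathcal O$: sources and targets of elements of $\mathcal O'$ lie in $\mathcal O$, units over $\mathcal O$ lie in $\mathcal O'$, and $\mathcal O'$ is closed under inverses and products of composable elements. 2. $\mathcal O'$ and $\mathcal O$ carry manifold structures for which the inclusions $\mathcal O'\hookrightarrow M_1$ and $\mathcal O\hookrightarrow M_0$ are immersions and which are the orbit structures: the target maps from the source-fibre of $G_1\rightrightarrows M_1$ over $1_u$ onto $\mathcal O'$ and from the source-fibre of $G_0\rightrightarrows M_0$ over $u$ onto $\mathcal O$ (source-fibres having their embedded submanifold structures) are submersions. If $G_1$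 (respectively $G_0$) is second-countable, so is $\mathcal O'$ (respectively $\mathcal O$). 3. With these manifold structures and the restricted structure maps, $\mathcal O'\rightrightarrows\mathcal O$ is a smooth groupoid. -/

import Mathlib

open scoped Manifold ContDiff
open Manifold

universe u v

/-! ### Groupoids presented by their structure maps -/

/-- A groupoid `G ⇉ M`. A pair `(g, h)` is composable when `src g = tgt h`, and its product is
then `mul g h`. The value of `mul` on non-composable pairs is irrelevant: no axiom and no later
definition refers to it. -/
structure Grpd (G : Type u) (M : Type v) where
  src : G → M
  tgt : G → M
  unit : M → G
  inv : G → G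
  mul : G → G → G
  src_unit : ∀ x, src (unit x) = x
  tgt_unit : ∀ x, tgt (unit x) = x
  src_inv : ∀ g, src (inv g) = tgt g
  tgt_inv : ∀ g, tgt (inv g) = src g
  src_mul : ∀ g h, src g = tgt h → src (mul g h) = src h
  tgt_mul : ∀ g h, src g = tgt h → tgt (mul g h) = tgt g
  mul_assoc : ∀ f g h, src f = tgt g → src g = tgt h → mul (mul f g) h = mul f (mul g h)
  unit_mul : ∀ g, mul (unit (tgt g)) g = g
  mul_unit : ∀ g, mul g (unit (src g)) = g
  inv_mul : ∀ g, mul (inv g) g = unit (src g)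
  mul_inv : ∀ g, mul g (inv g) = unit (tgt g)

/-- The underlying type of a set, carrying *no* topology of its own (the subtype would carry the
subspace topology, which is the wrong one on an immersed submanifold). -/
def Bare {X : Type u} (s : Set X) : Type u := {x // x ∈ s}

/-- The inclusion of a set. -/
def Bare.val {X : Type u} {s : Set X} (x : Bare s) : X := Subtype.val x

theorem Bare.ext {X : Type u} {s : Set X} {x y : Bare s} (h : x.val = y.val) : x = y :=
  Subtype.ext h

theorem Bare.val_mem {X : Type u} {s : Set X} (x : Bare s) : x.val ∈ s := Subtype.property x

/-- A point of a set, as an element of its underlying type. -/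
def Bare.mk {X : Type u} {s : Set X} (x : X) (h : x ∈ s) : Bare s := ⟨x, h⟩

theorem Bare.val_mk {X : Type u} {s : Set X} (x : X) (h : x ∈ s) : (Bare.mk x h).val = x := rfl

namespace Grpd

variable {G : Type u} {M : Type v}

/-- The orbit of `x`: all targets of arrows with source `x`. -/
def orbit (A : Grpd G M) (x : M) : Set M := A.tgt '' {g | A.src g = x}

/-- The source fibre over `x`; as a subtype of `G` it carries the subspace topology. -/
abbrev SrcFibre (A : Grpd G M) (x : M) : Type u := {g : G // A.src g = x}

/-- The target map, as a map from the source fibre over `x` onto the orbit of `x`. -/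
def toOrbit (A : Grpd G M) (x : M) (g : A.SrcFibre x) : Bare (A.orbit x) :=
  Bare.mk (A.tgt g.1) ⟨g.1, g.2, rfl⟩

/-- `s ⊆ G` is a subgroupoid of `G ⇉ M` over `s₀ ⊆ M`. -/
structure IsSubgroupoid (A : Grpd G M) (s : Set G) (s₀ : Set M) : Prop where
  src_mem : ∀ g ∈ s, A.src g ∈ s₀
  tgt_mem : ∀ g ∈ s, A.tgt g ∈ s₀
  unit_mem : ∀ x ∈ s₀, A.unit x ∈ s
  inv_mem : ∀ g ∈ s, A.inv g ∈ s
  mul_mem : ∀ g ∈ s, ∀ h ∈ s, A.src g = A.tgt h → A.mul g h ∈ s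

open Classical in
/-- The groupoid `s ⇉ s₀` given by a subgroupoid: all structure maps are restrictions of those of
`G ⇉ M`. -/
noncomputable def IsSubgroupoid.restrict {A : Grpd G M} {s : Set G} {s₀ : Set M}
    (hs : A.IsSubgroupoid s s₀) : Grpd (Bare s) (Bare s₀) where
  src g := Bare.mk (A.src g.val) (hs.src_mem _ g.val_mem)
  tgt g := Bare.mk (A.tgt g.val) (hs.tgt_mem _ g.val_mem)
  unit x := Bare.mk (A.unit x.val) (hs.unit_mem _ x.val_mem)
  inv g := Bare.mk (A.inv g.val) (hs.inv_mem _ g.val_mem)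
  mul g h := if e : A.src g.val = A.tgt h.val
    then Bare.mk (A.mul g.val h.val) (hs.mul_mem _ g.val_mem _ h.val_mem e) else g
  src_unit x := Bare.ext (A.src_unit _)
  tgt_unit x := Bare.ext (A.tgt_unit _)
  src_inv g := Bare.ext (A.src_inv _)
  tgt_inv g := Bare.ext (A.tgt_inv _)
  src_mul g h e := by
    have e' : A.src g.val = A.tgt h.val := congrArg Bare.val e
    apply Bare.ext
    simp only [dif_pos e', Bare.val_mk]
    exact A.src_mul _ _ e'
  tgt_mul g h e := by
    have e' : A.src g.val = A.tgt h.val := congrArg Bare.val e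
    apply Bare.ext
    simp only [dif_pos e', Bare.val_mk]
    exact A.tgt_mul _ _ e'
  mul_assoc f g h e₁ e₂ := by
    have e₁' : A.src f.val = A.tgt g.val := congrArg Bare.val e₁
    have e₂' : A.src g.val = A.tgt h.val := congrArg Bare.val e₂
    have e₃ : A.src (A.mul f.val g.val) = A.tgt h.val := (A.src_mul _ _ e₁').trans e₂'
    have e₄ : A.src f.val = A.tgt (A.mul g.val h.val) := e₁'.trans (A.tgt_mul _ _ e₂').symm
    apply Bare.ext
    simp only [dif_pos e₁', dif_pos e₂', Bare.val_mk, dif_pos e₃, dif_pos e₄]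
    exact A.mul_assoc _ _ _ e₁' e₂'
  unit_mul g := Bare.ext ((congrArg Bare.val (dif_pos (A.src_unit (A.tgt g.val)))).trans (A.unit_mul _))
  mul_unit g := Bare.ext ((congrArg Bare.val (dif_pos (A.tgt_unit (A.src g.val)).symm)).trans (A.mul_unit _))
  inv_mul g := Bare.ext ((congrArg Bare.val (dif_pos (A.src_inv g.val))).trans (A.inv_mul _))
  mul_inv g := Bare.ext ((congrArg Bare.val (dif_pos (A.tgt_inv g.val).symm)).trans (A.mul_inv _))

/-- `f : G → G'` is a morphism of groupoids over `f₀ : M → M'`. -/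
structure IsHom {G' : Type*} {M' : Type*} (A : Grpd G M) (B : Grpd G' M')
    (f : G → G') (f₀ : M → M') : Prop where
  map_src : ∀ g, B.src (f g) = f₀ (A.src g)
  map_tgt : ∀ g, B.tgt (f g) = f₀ (A.tgt g)
  map_unit : ∀ x, f (A.unit x) = B.unit (f₀ x)
  map_mul : ∀ g h, A.src g = A.tgt h → f (A.mul g h) = B.mul (f g) (f h)

/-! ### Smooth groupoids

Manifolds are smooth, finite-dimensional, without boundary and not necessarily Hausdorff: a
manifold of dimension `n` is a topological space with a `ChartedSpace (EuclideanSpace ℝ (Fin n))`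
and an `IsManifold (𝓡 n) ∞` instance. -/

/-- A smooth groupoid: all structure maps are smooth and the source is a submersion. Smoothness of
the multiplication on the fibre product `{(g, h) | src g = tgt h}`, an embedded submanifold of
`G × G`, is smoothness on that subset. -/
structure IsSmooth (n m : ℕ)
    [TopologicalSpace G] [ChartedSpace (EuclideanSpace ℝ (Fin n)) G] [IsManifold (𝓡 n) ∞ G]
    [TopologicalSpace M] [ChartedSpace (EuclideanSpace ℝ (Fin m)) M] [IsManifold (𝓡 m) ∞ M]
    (A : Grpd G M) : Prop where
  src_submersion : IsSubmersion (𝓡 n) (𝓡 m) ∞ A.src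
  tgt_smooth : ContMDiff (𝓡 n) (𝓡 m) ∞ A.tgt
  unit_smooth : ContMDiff (𝓡 m) (𝓡 n) ∞ A.unit
  inv_smooth : ContMDiff (𝓡 n) (𝓡 n) ∞ A.inv
  mul_smooth : ContMDiffOn ((𝓡 n).prod (𝓡 n)) (𝓡 n) ∞ (fun p : G × G => A.mul p.1 p.2)
    {p : G × G | A.src p.1 = A.tgt p.2}

/-- A Lie groupoid: a smooth groupoid whose base and source fibres are Hausdorff. -/
structure IsLie (n m : ℕ)
    [TopologicalSpace G] [ChartedSpace (EuclideanSpace ℝ (Fin n)) G] [IsManifold (𝓡 n) ∞ G]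
    [TopologicalSpace M] [ChartedSpace (EuclideanSpace ℝ (Fin m)) M] [IsManifold (𝓡 m) ∞ M]
    (A : Grpd G M) : Prop extends A.IsSmooth n m where
  t2_base : T2Space M
  t2_fibre : ∀ x, T2Space (A.SrcFibre x)

/-- A manifold structure (of dimension `k`) on the orbit of `x` is *the* immersed orbit structure
if the inclusion into `M` is an immersion and the target map, from the source fibre over `x` with
its embedded submanifold structure, is a submersion onto the orbit. -/
structure IsOrbitStructure (n m : ℕ)
    [TopologicalSpace G] [ChartedSpace (EuclideanSpace ℝ (Fin n)) G]
    [TopologicalSpace M] [ChartedSpace (EuclideanSpace ℝ (Fin m)) M]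
    (A : Grpd G M) (x : M) (k : ℕ)
    [TopologicalSpace (Bare (A.orbit x))]
    [ChartedSpace (EuclideanSpace ℝ (Fin k)) (Bare (A.orbit x))] : Prop where
  immersion : IsImmersion (𝓡 k) (𝓡 m) ∞ (Bare.val : Bare (A.orbit x) → M)
  submersion : ∃ (d : ℕ) (_ : ChartedSpace (EuclideanSpace ℝ (Fin d)) (A.SrcFibre x)),
    IsManifold (𝓡 d) ∞ (A.SrcFibre x) ∧
    IsSmoothEmbedding (𝓡 d) (𝓡 n) ∞ (Subtype.val : A.SrcFibre x → G) ∧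
    IsSubmersion (𝓡 d) (𝓡 k) ∞ (A.toOrbit x)

end Grpd

/-! ### Double groupoids -/

/-- Four groupoid structures
```
  G₁ ⇉ M₁
  ⇊    ⇊
  G₀ ⇉ M₀
```
form a double groupoid: the structure maps of `V : G₁ ⇉ G₀` over those of `S : M₁ ⇉ M₀` are
morphisms between `H : G₁ ⇉ M₁` and `T : G₀ ⇉ M₀`. For the multiplication, whose domain is the
fibre product groupoid of composable pairs, this is spelled out. -/
structure IsDoubleGroupoid {G₁ M₁ G₀ M₀ : Type*}
    (H : Grpd G₁ M₁) (V : Grpd G₁ G₀) (S : Grpd M₁ M₀) (T : Grpd G₀ M₀) : Prop where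
  src_hom : H.IsHom T V.src S.src
  tgt_hom : H.IsHom T V.tgt S.tgt
  unit_hom : T.IsHom H V.unit S.unit
  inv_hom : H.IsHom H V.inv S.inv
  src_mul : ∀ g h, V.src g = V.tgt h → H.src (V.mul g h) = S.mul (H.src g) (H.src h)
  tgt_mul : ∀ g h, V.src g = V.tgt h → H.tgt (V.mul g h) = S.mul (H.tgt g) (H.tgt h)
  unit_mul : ∀ x y, S.src x = S.tgt y → V.mul (H.unit x) (H.unit y) = H.unit (S.mul x y)
  interchange : ∀ g h g' h', V.src g = V.tgt h → V.src g' = V.tgt h' →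
    H.src g = H.tgt g' → H.src h = H.tgt h' →
    V.mul (H.mul g g') (H.mul h h') = H.mul (V.mul g h) (V.mul g' h')

/-- The fibre product `M₁ ×_{M₀} G₀` of the two source maps, with the subspace topology of
`M₁ × G₀`. -/
abbrev SrcPairs {M₁ G₀ M₀ : Type*} (S : Grpd M₁ M₀) (T : Grpd G₀ M₀) : Type _ :=
  {p : M₁ × G₀ // S.src p.1 = T.src p.2}

/-- The double source map `G₁ → M₁ ×_{M₀} G₀`. -/
def IsDoubleGroupoid.doubleSrc {G₁ M₁ G₀ M₀ : Type*} {H : Grpd G₁ M₁} {V : Grpd G₁ G₀}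
    {S : Grpd M₁ M₀} {T : Grpd G₀ M₀} (h : IsDoubleGroupoid H V S T) (g : G₁) : SrcPairs S T :=
  ⟨(H.src g, V.src g), (h.src_hom.map_src g).symm⟩

/-- A double Lie groupoid: a double groupoid such that `G₁ ⇉ M₁`, `G₁ ⇉ G₀` are smooth groupoids,
`M₁ ⇉ M₀`, `G₀ ⇉ M₀` are Lie groupoids, and the double source map is a submersion, where
`M₁ ×_{M₀} G₀` carries its structure of embedded submanifold of `M₁ × G₀`. -/
structure IsDoubleLieGroupoid {G₁ M₁ G₀ M₀ : Type*} (n₁ m₁ n₀ m₀ : ℕ)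
    [TopologicalSpace G₁] [ChartedSpace (EuclideanSpace ℝ (Fin n₁)) G₁] [IsManifold (𝓡 n₁) ∞ G₁]
    [TopologicalSpace M₁] [ChartedSpace (EuclideanSpace ℝ (Fin m₁)) M₁] [IsManifold (𝓡 m₁) ∞ M₁]
    [TopologicalSpace G₀] [ChartedSpace (EuclideanSpace ℝ (Fin n₀)) G₀] [IsManifold (𝓡 n₀) ∞ G₀]
    [TopologicalSpace M₀] [ChartedSpace (EuclideanSpace ℝ (Fin m₀)) M₀] [IsManifold (𝓡 m₀) ∞ M₀]
    (H : Grpd G₁ M₁) (V : Grpd G₁ G₀) (S : Grpd M₁ M₀) (T : Grpd G₀ M₀) : Prop where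
  double : IsDoubleGroupoid H V S T
  smooth_H : H.IsSmooth n₁ m₁
  smooth_V : V.IsSmooth n₁ n₀
  lie_S : S.IsLie m₁ m₀
  lie_T : T.IsLie n₀ m₀
  doubleSrc_submersion : ∃ (d : ℕ) (_ : ChartedSpace (EuclideanSpace ℝ (Fin d)) (SrcPairs S T)),
    IsManifold (𝓡 d) ∞ (SrcPairs S T) ∧
    IsSmoothEmbedding (𝓡 d) ((𝓡 m₁).prod (𝓡 n₀)) ∞ (Subtype.val : SrcPairs S T → M₁ × G₀) ∧
    IsSubmersion (𝓡 n₁) (𝓡 d) ∞ double.doubleSrc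

/-! The orbit of `x` in a smooth groupoid is the image of the source fibre F over `x` under the
target map. This map has constant rank on F: for arrows h₁, h₂ with the same source, multiplying on
the left by a local section of the source through h₂h₁⁻¹ carries h₁ to h₂ and maps the vectors
killed by both source and target injectively to such vectors (`finrank_isotropyTangent_le`). Arrows
of F with equal targets differ by right multiplication with an isotropy arrow at `x`, so the
projection of F to the orbit, with the quotient topology, is open (`isOpenQuotientMap_toOrbit`). The
constant rank theorem brings F → orbit → M locally into the form (a, b) ↦ a ↦ (a, 0), and the
coordinates a are the charts of the orbit (`exists_isOrbitStructure`).

In a double Lie groupoid let F₁ be the fibre of `H` over 1_u and F₀ that of `T` over `u`. As 1_u is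
a unit, the source, target, units and inversion of `V` restrict to F₁ and F₀; there they lift the
corresponding maps of `S` between the orbits. Multiplication needs a correction: if g, h in F₁
represent composable points, the vertical source of g and the vertical target of h need not agree,
but they are arrows of F₀ with the same target. So they differ by an isotropy arrow k at `u`, and
replacing h by h·1_k makes the vertical product defined without moving the horizontal target of h
(`adjustedMul`).

The lifts are continuous, hence so are the maps between the quotients. A continuous map into an
immersed manifold is smooth as soon as it is smooth into the ambient one, and this settles every
structure map. That the source is a submersion comes from the double source map: its local sections,
restricted to {1_u} × F₀, are local sections of F₁ → F₀ (`exists_section_fibre`) and induce local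
sections between the orbits. -/

/-! ### Inverse function theorem and constant rank theorem in vector spaces -/

section Calculus

open Set Filter Topology

variable {E F A K C : Type*} [NormedAddCommGroup E] [NormedSpace ℝ E] [FiniteDimensional ℝ E]
  [NormedAddCommGroup F] [NormedSpace ℝ F]
  [NormedAddCommGroup A] [NormedSpace ℝ A] [FiniteDimensional ℝ A]
  [NormedAddCommGroup K] [NormedSpace ℝ K] [FiniteDimensional ℝ K]
  [NormedAddCommGroup C] [NormedSpace ℝ C] [FiniteDimensional ℝ C]

/-- A surjective linear map is the first component of a linear isomorphism onto a product. -/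
theorem exists_continuousLinearEquiv_prod_of_surjective (p : E →L[ℝ] A)
    (hp : Function.Surjective p)
    (hd : Module.finrank ℝ A + Module.finrank ℝ K = Module.finrank ℝ E) :
    ∃ L : E ≃L[ℝ] A × K, ∀ v, (L v).1 = p v := by
  have hk : Module.finrank ℝ p.ker = Module.finrank ℝ K := by
    have h1 := LinearMap.finrank_range_add_finrank_ker (p : E →ₗ[ℝ] A)
    have h2 : (p : E →ₗ[ℝ] A).range = ⊤ := LinearMap.range_eq_top.2 hp
    rw [h2, finrank_top] at h1
    change Module.finrank ℝ (LinearMap.ker (p : E →ₗ[ℝ] A)) = _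
    omega
  let e : p.ker ≃L[ℝ] K := ContinuousLinearEquiv.ofFinrankEq hk
  obtain ⟨q, hq⟩ := (Submodule.ClosedComplemented.of_finiteDimensional p.ker)
  -- The second coordinate, a projection onto `p.ker`, separates the vectors that `p` identifies;
  -- injectivity and the dimension count then give an isomorphism.
  let T : E →L[ℝ] A × K := p.prod ((e : p.ker →L[ℝ] K).comp q)
  have hT : Function.Injective (T : E →ₗ[ℝ] A × K) := by
    rw [injective_iff_map_eq_zero]
    intro v hv
    have h1 : p v = 0 := congrArg Prod.fst hv
    have h2 : e (q v) = 0 := congrArg Prod.snd hv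
    have h3 : q v = 0 := by simpa using h2
    have h4 := hq ⟨v, h1⟩
    simp only at h4
    rw [h3] at h4
    exact (congrArg Subtype.val h4).symm
  let L := LinearEquiv.ofInjectiveOfFinrankEq (T : E →ₗ[ℝ] A × K) hT (by simp [hd])
  exact ⟨L.toContinuousLinearEquiv, fun v => rfl⟩

/-- The inverse function theorem, with smoothness of the local inverse on its whole domain. -/
theorem ContDiffOn.exists_openPartialHomeomorph {f : E → F} {U : Set E} (hU : IsOpen U)
    (hf : ContDiffOn ℝ ∞ f U) {x : E} (hx : x ∈ U) (f' : E ≃L[ℝ] F)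
    (hf' : HasFDerivAt f (f' : E →L[ℝ] F) x) :
    ∃ Φ : OpenPartialHomeomorph E F, x ∈ Φ.source ∧ Φ.source ⊆ U ∧ ⇑Φ = f ∧
      ContDiffOn ℝ ∞ Φ.symm Φ.target := by
  have := FiniteDimensional.complete ℝ E
  have hfx : ContDiffAt ℝ ∞ f x := hf.contDiffAt (hU.mem_nhds hx)
  let Φ₀ := hfx.toOpenPartialHomeomorph f hf' (by simp)
  -- Smoothness of the inverse at a point needs an invertible derivative at its preimage, so the
  -- domain is cut down to the open set where the derivative is invertible.
  let V : Set E := U ∩ fderiv ℝ f ⁻¹' range ((↑) : (E ≃L[ℝ] F) → E →L[ℝ] F)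
  have hV : IsOpen V :=
    (hf.continuousOn_fderiv_of_isOpen hU (by simp)).isOpen_inter_preimage hU
      (ContinuousLinearEquiv.isOpen (𝕜 := ℝ) (E := E) (F := F))
  have hxV : x ∈ V := ⟨hx, f', hf'.fderiv.symm⟩
  refine ⟨Φ₀.restrOpen V hV, ⟨hfx.mem_toOpenPartialHomeomorph_source hf' _, hxV⟩,
    fun y hy => hy.2.1, rfl, ?_⟩
  intro z hz
  have hy := (Φ₀.restrOpen V hV).map_target hz
  obtain ⟨-, hyU, e, he⟩ := hy
  refine ((Φ₀.restrOpen V hV).contDiffAt_symm (f₀' := e) hz ?_ ?_).contDiffWithinAt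
  · have hd : DifferentiableAt ℝ f ((Φ₀.restrOpen V hV).symm z) :=
      (hf.contDiffAt (hU.mem_nhds hyU)).differentiableAt (by simp)
    rw [he]
    exact hd.hasFDerivAt
  · exact hf.contDiffAt (hU.mem_nhds hyU)

/-- Straightening of a submersion between vector spaces. -/
theorem ContDiffOn.exists_straightening {p : E → A} {U : Set E} (hU : IsOpen U)
    (hp : ContDiffOn ℝ ∞ p U) {x : E} (hx : x ∈ U) (hs : Function.Surjective (fderiv ℝ p x))
    (hd : Module.finrank ℝ A + Module.finrank ℝ K = Module.finrank ℝ E) :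
    ∃ Φ : OpenPartialHomeomorph E (A × K), x ∈ Φ.source ∧ Φ.source ⊆ U ∧
      (∀ y, (Φ y).1 = p y) ∧
      ContDiffOn ℝ ∞ Φ Φ.source ∧ ContDiffOn ℝ ∞ Φ.symm Φ.target := by
  obtain ⟨L, hL⟩ := exists_continuousLinearEquiv_prod_of_surjective (K := K) _ hs hd
  -- A complementary linear coordinate completes `p` to a map whose derivative at `x` is exactly
  -- `L`.
  let f : E → A × K := fun y => (p y, (L y).2)
  have hf : ContDiffOn ℝ ∞ f U :=
    hp.prodMk ((contDiff_snd.comp L.contDiff).contDiffOn)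
  have hpx : HasFDerivAt p (fderiv ℝ p x) x :=
    ((hp.contDiffAt (hU.mem_nhds hx)).differentiableAt (by simp)).hasFDerivAt
  have hf' : HasFDerivAt f (L : E →L[ℝ] A × K) x := by
    have h := hpx.prodMk (((ContinuousLinearMap.snd ℝ A K).comp
      (L : E →L[ℝ] A × K)).hasFDerivAt (x := x))
    have hLf : (L : E →L[ℝ] A × K) = (fderiv ℝ p x).prod
        ((ContinuousLinearMap.snd ℝ A K).comp (L : E →L[ℝ] A × K)) :=
      ContinuousLinearMap.ext fun v => Prod.ext (hL v) rfl
    rw [hLf]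
    exact h
  obtain ⟨Φ, h1, h2, h3, h4⟩ := hf.exists_openPartialHomeomorph hU hx L hf'
  exact ⟨Φ, h1, h2, fun y => by rw [h3], by rw [h3]; exact hf.mono h2, h4⟩

/-- The shear `(a, c) ↦ (a, c - γ a)` over an open set. -/
noncomputable def OpenPartialHomeomorph.shear (γ : A → C) (B : Set A) (hB : IsOpen B)
    (hγ : ContDiffOn ℝ ∞ γ B) : OpenPartialHomeomorph (A × C) (A × C) where
  toFun z := (z.1, z.2 - γ z.1)
  invFun z := (z.1, z.2 + γ z.1)
  source := Prod.fst ⁻¹' B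
  target := Prod.fst ⁻¹' B
  map_source' _ h := h
  map_target' _ h := h
  left_inv' z _ := by simp
  right_inv' z _ := by simp
  open_source := hB.preimage continuous_fst
  open_target := hB.preimage continuous_fst
  continuousOn_toFun := continuousOn_fst.prodMk
    (continuousOn_snd.sub (hγ.continuousOn.comp continuousOn_fst fun _ h => h))
  continuousOn_invFun := continuousOn_fst.prodMk
    (continuousOn_snd.add (hγ.continuousOn.comp continuousOn_fst fun _ h => h))

/-- The constant rank theorem. -/
theorem ContDiffOn.exists_constant_rank_form [FiniteDimensional ℝ F] {f : E → F} {U : Set E} (hU : IsOpen U)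
    (hf : ContDiffOn ℝ ∞ f U) {x : E} (hx : x ∈ U)
    (hr : ∀ y ∈ U, Module.finrank ℝ (fderiv ℝ f y).range = Module.finrank ℝ A)
    (hE : Module.finrank ℝ A + Module.finrank ℝ K = Module.finrank ℝ E)
    (hF : Module.finrank ℝ A + Module.finrank ℝ C = Module.finrank ℝ F) :
    ∃ (Φ : OpenPartialHomeomorph E (A × K)) (Ψ : OpenPartialHomeomorph F (A × C)),
      x ∈ Φ.source ∧ Φ.source ⊆ U ∧ MapsTo f Φ.source Ψ.source ∧
      (∀ y ∈ Φ.source, Ψ (f y) = ((Φ y).1, 0)) ∧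
      ContDiffOn ℝ ∞ Φ Φ.source ∧ ContDiffOn ℝ ∞ Φ.symm Φ.target ∧
      ContDiffOn ℝ ∞ Ψ Ψ.source ∧ ContDiffOn ℝ ∞ Ψ.symm Ψ.target := by
  have hdf : ∀ y ∈ U, HasFDerivAt f (fderiv ℝ f y) y := fun y hy =>
    ((hf.contDiffAt (hU.mem_nhds hy)).differentiableAt (by simp)).hasFDerivAt
  -- The splitting of `F` is chosen so that its first component stays surjective on the image of the
  -- derivative at `x`.
  obtain ⟨L, hL⟩ : ∃ L : F ≃L[ℝ] A × C,
      Function.Surjective fun v => (L (fderiv ℝ f x v)).1 := by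
    obtain ⟨π, hπ⟩ := Submodule.ClosedComplemented.of_finiteDimensional (fderiv ℝ f x).range
    let e : (fderiv ℝ f x).range ≃L[ℝ] A := ContinuousLinearEquiv.ofFinrankEq (hr x hx)
    have hsurj : ∀ a, ∃ v, e (π (fderiv ℝ f x v)) = a := by
      intro a
      obtain ⟨v, hv⟩ := (e.symm a).2
      refine ⟨v, ?_⟩
      have h1 := hπ (e.symm a)
      rw [← hv] at h1
      have h2 : π (fderiv ℝ f x v) = e.symm a := h1
      rw [h2, e.apply_symm_apply]
    obtain ⟨L, hL⟩ := exists_continuousLinearEquiv_prod_of_surjective (K := C)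
      ((e : (fderiv ℝ f x).range →L[ℝ] A).comp π)
      (fun a => (hsurj a).imp' (fderiv ℝ f x) fun _ h => h) hF
    exact ⟨L, fun a => (hsurj a).imp fun v hv => (hL _).trans hv⟩
  let P : F →L[ℝ] A := (ContinuousLinearMap.fst ℝ A C).comp (L : F →L[ℝ] A × C)
  let Q : F →L[ℝ] C := (ContinuousLinearMap.snd ℝ A C).comp (L : F →L[ℝ] A × C)
  let p : E → A := fun y => P (f y)
  have hp : ContDiffOn ℝ ∞ p U := P.contDiff.comp_contDiffOn hf
  have hdp : ∀ y ∈ U, HasFDerivAt p (P.comp (fderiv ℝ f y)) y := fun y hy =>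
    P.hasFDerivAt.comp y (hdf y hy)
  obtain ⟨Φ₀, hx0, hU0, hΦp, hΦs, hΦt⟩ := hp.exists_straightening (K := K) hU hx
    (by rw [(hdp x hx).fderiv]; exact hL) hE
  -- The chart is cut down to a product of balls, so that every slice in the direction of `K` is
  -- connected.
  obtain ⟨ε, hε, hball⟩ := Metric.isOpen_iff.1 Φ₀.open_target _ (Φ₀.map_source hx0)
  set a₀ := (Φ₀ x).1
  set b₀ := (Φ₀ x).2
  let B₁ : Set A := Metric.ball a₀ ε
  let B₂ : Set K := Metric.ball b₀ ε
  have hbox : B₁ ×ˢ B₂ ⊆ Φ₀.target := by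
    refine subset_trans ?_ hball
    rw [ball_prod_same]
  have hboxo : IsOpen (B₁ ×ˢ B₂) := Metric.isOpen_ball.prod Metric.isOpen_ball
  let Φ : OpenPartialHomeomorph E (A × K) := (Φ₀.symm.restrOpen (B₁ ×ˢ B₂) hboxo).symm
  have hΦsrc : Φ.source ⊆ Φ₀.source ∩ Φ₀ ⁻¹' (B₁ ×ˢ B₂) := by
    intro y hy
    have := Φ.map_source hy
    have h2 := Φ.left_inv hy
    refine ⟨?_, this.2⟩
    rw [← h2]
    exact Φ₀.map_target this.1
  let c : A × K → C := fun z => Q (f (Φ₀.symm z))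
  have hcs : ContDiffOn ℝ ∞ c (B₁ ×ˢ B₂) :=
    (Q.contDiff.comp_contDiffOn hf).comp (hΦt.mono hbox)
      fun z hz => hU0 (Φ₀.map_target (hbox hz))
  -- the derivative of `c` in the direction of `K` vanishes
  have hker : ∀ y ∈ Φ₀.source, (P.comp (fderiv ℝ f y)).ker ≤ (fderiv ℝ f y).ker := by
    intro y hy
    have hyU := hU0 hy
    -- One inclusion of kernels is clear; both have codimension dim `A`, on the left by the rank
    -- hypothesis and on the right because `P ∘ f` is a submersion here, so they coincide.
    have hle : (fderiv ℝ f y).ker ≤ (P.comp (fderiv ℝ f y)).ker := by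
      intro v hv
      have hv : fderiv ℝ f y v = 0 := hv
      change P (fderiv ℝ f y v) = 0
      rw [hv, map_zero]
    have hsurj : (P.comp (fderiv ℝ f y)).range = ⊤ := by
      -- `p ∘ Φ₀.symm` is the first projection
      have h1 : HasFDerivAt (fun z => p (Φ₀.symm z))
          ((P.comp (fderiv ℝ f y)).comp (fderiv ℝ Φ₀.symm (Φ₀ y))) (Φ₀ y) := by
        have h2 := ((hΦt.contDiffAt (Φ₀.open_target.mem_nhds
          (Φ₀.map_source hy))).differentiableAt (by simp)).hasFDerivAt
        have h3 := hdp y hyU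
        rw [← Φ₀.left_inv hy] at h3
        have := h3.comp (Φ₀ y) h2
        rwa [Φ₀.left_inv hy] at this
      have h2 : (fun z => p (Φ₀.symm z)) =ᶠ[𝓝 (Φ₀ y)] Prod.fst := by
        filter_upwards [Φ₀.open_target.mem_nhds (Φ₀.map_source hy)] with z hz
        rw [← hΦp, Φ₀.right_inv hz]
      have h3 := h1.unique (hasFDerivAt_fst.congr_of_eventuallyEq h2)
      refine LinearMap.range_eq_top.2 fun a => ⟨fderiv ℝ Φ₀.symm (Φ₀ y) (a, 0), ?_⟩
      exact DFunLike.congr_fun h3 (a, 0)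
    have h1 := LinearMap.finrank_range_add_finrank_ker (fderiv ℝ f y : E →ₗ[ℝ] F)
    have h2 := LinearMap.finrank_range_add_finrank_ker (P.comp (fderiv ℝ f y) : E →ₗ[ℝ] A)
    have h3 := hr y hyU
    change Module.finrank ℝ (P.comp (fderiv ℝ f y)).range +
      Module.finrank ℝ (P.comp (fderiv ℝ f y)).ker = _ at h2
    change Module.finrank ℝ (fderiv ℝ f y).range + Module.finrank ℝ (fderiv ℝ f y).ker = _ at h1
    rw [hsurj, finrank_top] at h2
    exact (Submodule.eq_of_le_of_finrank_eq hle (by omega)).ge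
  have hc0 : ∀ a ∈ B₁, ∀ b ∈ B₂, c (a, b) = c (a, b₀) := by
    intro a ha b hb
    refine Metric.isOpen_ball.is_const_of_fderiv_eq_zero (𝕜 := ℝ) (f := fun b => c (a, b))
      (convex_ball b₀ ε).isPreconnected ?_ ?_ hb (Metric.mem_ball_self hε)
    · intro b hb
      refine DifferentiableAt.differentiableWithinAt ?_
      have := (hcs.contDiffAt (hboxo.mem_nhds (x := (a, b)) ⟨ha, hb⟩)).differentiableAt (by simp)
      exact this.comp b ((differentiableAt_const a).prodMk differentiableAt_id)
    · intro b hb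
      have hz : (a, b) ∈ Φ₀.target := hbox ⟨ha, hb⟩
      set y := Φ₀.symm (a, b) with hy
      have hys : y ∈ Φ₀.source := Φ₀.map_target hz
      have h1 : HasFDerivAt (fun b => Φ₀.symm (a, b))
          ((fderiv ℝ Φ₀.symm (a, b)).comp (ContinuousLinearMap.inr ℝ A K)) b := by
        have h2 := ((hΦt.contDiffAt (Φ₀.open_target.mem_nhds hz)).differentiableAt
          (by simp)).hasFDerivAt
        exact h2.comp b ((hasFDerivAt_const a b).prodMk (hasFDerivAt_id b))
      have h2 : HasFDerivAt (fun b => f (Φ₀.symm (a, b))) ((fderiv ℝ f y).comp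
          ((fderiv ℝ Φ₀.symm (a, b)).comp (ContinuousLinearMap.inr ℝ A K))) b :=
        (hdf y (hU0 hys)).comp b h1
      have h3 : (P.comp (fderiv ℝ f y)).comp
          ((fderiv ℝ Φ₀.symm (a, b)).comp (ContinuousLinearMap.inr ℝ A K)) = 0 := by
        have h4 : HasFDerivAt (fun b => p (Φ₀.symm (a, b)))
            ((P.comp (fderiv ℝ f y)).comp
              ((fderiv ℝ Φ₀.symm (a, b)).comp (ContinuousLinearMap.inr ℝ A K))) b :=
          HasFDerivAt.comp (f := fun b => Φ₀.symm (a, b)) (g := p) b (hdp y (hU0 hys)) h1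
        refine h4.unique ((hasFDerivAt_const a b).congr_of_eventuallyEq ?_)
        filter_upwards [Metric.isOpen_ball.mem_nhds hb] with b' hb'
        rw [← hΦp, Φ₀.right_inv (hbox ⟨ha, hb'⟩)]
      have h4 : (fderiv ℝ f y).comp
          ((fderiv ℝ Φ₀.symm (a, b)).comp (ContinuousLinearMap.inr ℝ A K)) = 0 := by
        ext w
        exact hker y hys (DFunLike.congr_fun h3 w)
      rw [h4] at h2
      have h5 := (Q.hasFDerivAt.comp b h2).fderiv
      rw [ContinuousLinearMap.comp_zero] at h5
      exact h5
  -- Since `c` does not depend on the `K`-coordinate, the image of `f` is locally the graph of `γ`,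
  -- which a shear flattens.
  let γ : A → C := fun a => c (a, b₀)
  have hγ : ContDiffOn ℝ ∞ γ B₁ := hcs.comp ((contDiff_id.prodMk contDiff_const).contDiffOn)
    fun a ha => ⟨ha, Metric.mem_ball_self hε⟩
  let τ := OpenPartialHomeomorph.shear γ B₁ Metric.isOpen_ball hγ
  have hτ₁ : ContDiffOn ℝ ∞ τ τ.source := contDiffOn_fst.prodMk
    (contDiffOn_snd.sub (hγ.comp contDiffOn_fst fun _ h => h))
  have hτ₂ : ContDiffOn ℝ ∞ τ.symm τ.target := contDiffOn_fst.prodMk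
    (contDiffOn_snd.add (hγ.comp contDiffOn_fst fun _ h => h))
  refine ⟨Φ, L.toHomeomorph.toOpenPartialHomeomorph.trans τ, ?_, fun y hy => hU0 (hΦsrc hy).1,
    ?_, ?_, hΦs.mono fun y hy => (hΦsrc hy).1, hΦt.mono fun z hz => hz.1, ?_, ?_⟩
  · have : Φ₀ x ∈ Φ.target := ⟨Φ₀.map_source hx0, Metric.mem_ball_self hε, Metric.mem_ball_self hε⟩
    have h2 := Φ.map_target this
    have h3 : Φ.symm (Φ₀ x) = x := Φ₀.left_inv hx0
    rwa [h3] at h2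
  · intro y hy
    refine ⟨trivial, ?_⟩
    have := (hΦsrc hy).2.1
    rw [hΦp] at this
    exact this
  · intro y hy
    have h1 := hΦsrc hy
    refine Prod.ext (hΦp y).symm ?_
    have h2 := hc0 _ h1.2.1 _ h1.2.2
    change Q (f y) - c (P (f y), b₀) = 0
    have h3 : P (f y) = (Φ₀ y).1 := (hΦp y).symm
    rw [h3, ← h2, sub_eq_zero]
    change _ = Q (f (Φ₀.symm (Φ₀ y)))
    rw [Φ₀.left_inv h1.1]
  · exact hτ₁.comp L.contDiff.contDiffOn fun y hy => hy.2
  · exact L.symm.contDiff.comp_contDiffOn (hτ₂.mono fun z hz => hz.1)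

end Calculus

/-! ### Submersions, immersions and maps of constant rank between manifolds -/

section Manifolds

open Set Filter Topology IsManifold

variable {E E' F A K C : Type*} [NormedAddCommGroup E] [NormedSpace ℝ E]
  [NormedAddCommGroup E'] [NormedSpace ℝ E']
  [NormedAddCommGroup F] [NormedSpace ℝ F]
  [NormedAddCommGroup A] [NormedSpace ℝ A]
  [NormedAddCommGroup K] [NormedSpace ℝ K]
  [NormedAddCommGroup C] [NormedSpace ℝ C]
  {M N : Type*} [TopologicalSpace M] [ChartedSpace E M]
  [TopologicalSpace N] [ChartedSpace E' N]

/-- Composing a chart with a local diffeomorphism of the model space gives a chart. -/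
theorem IsManifold.trans_mem_maximalAtlas [IsManifold 𝓘(ℝ, E) ∞ M]
    {φ : OpenPartialHomeomorph M E} (hφ : φ ∈ maximalAtlas 𝓘(ℝ, E) ∞ M)
    {Φ : OpenPartialHomeomorph E A} (hΦ : ContDiffOn ℝ ∞ Φ Φ.source)
    (hΦ' : ContDiffOn ℝ ∞ Φ.symm Φ.target) (L : A ≃L[ℝ] E) :
    (φ.trans (Φ.trans L.toHomeomorph.toOpenPartialHomeomorph)) ∈ maximalAtlas 𝓘(ℝ, E) ∞ M := by
  rw [mem_maximalAtlas_iff_contMDiffOn] at hφ ⊢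
  constructor
  · refine (ContDiffOn.contMDiffOn ?_ : ContMDiffOn 𝓘(ℝ, E) 𝓘(ℝ, E) ∞
      (Φ.trans L.toHomeomorph.toOpenPartialHomeomorph) Φ.source).comp
      (hφ.1.mono fun y hy => hy.1) fun y hy => hy.2.1
    exact L.contDiff.comp_contDiffOn hΦ
  · refine hφ.2.comp (t := φ.target) (ContDiffOn.contMDiffOn ?_) fun y hy => hy.2
    exact (hΦ'.comp L.symm.contDiff.contDiffOn fun y hy => hy.1.2)

/-- The local normal form of a submersion. -/
theorem Manifold.IsSubmersionAtOfComplement.exists_charts {f : M → N} {x : M}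
    (h : IsSubmersionAtOfComplement F 𝓘(ℝ, E) 𝓘(ℝ, E') ∞ f x) :
    ∃ φ ∈ maximalAtlas 𝓘(ℝ, E) ∞ M, ∃ ψ ∈ maximalAtlas 𝓘(ℝ, E') ∞ N, ∃ L : E ≃L[ℝ] E' × F,
      x ∈ φ.source ∧ MapsTo f φ.source ψ.source ∧ ∀ y ∈ φ.source, ψ (f y) = (L (φ y)).1 := by
  refine ⟨h.domChart, h.domChart_mem_maximalAtlas, h.codChart, h.codChart_mem_maximalAtlas,
    h.equiv, h.mem_domChart_source, h.mapsto_domChart_source_codChart_source, fun y hy => ?_⟩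
  have hy' : h.domChart y ∈ (h.domChart.extend 𝓘(ℝ, E)).target := by
    simpa using h.domChart.map_source hy
  have h1 := h.writtenInCharts hy'
  simpa [h.domChart.left_inv hy] using h1

/-- The local normal form of an immersion. -/
theorem Manifold.IsImmersionAtOfComplement.exists_charts {f : M → N} {x : M}
    (h : IsImmersionAtOfComplement F 𝓘(ℝ, E) 𝓘(ℝ, E') ∞ f x) :
    ∃ φ ∈ maximalAtlas 𝓘(ℝ, E) ∞ M, ∃ ψ ∈ maximalAtlas 𝓘(ℝ, E') ∞ N, ∃ L : (E × F) ≃L[ℝ] E',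
      x ∈ φ.source ∧ MapsTo f φ.source ψ.source ∧ ∀ y ∈ φ.source, ψ (f y) = L (φ y, 0) := by
  refine ⟨h.domChart, h.domChart_mem_maximalAtlas, h.codChart, h.codChart_mem_maximalAtlas,
    h.equiv, h.mem_domChart_source, h.source_subset_preimage_source, fun y hy => ?_⟩
  have hy' : h.domChart y ∈ (h.domChart.extend 𝓘(ℝ, E)).target := by
    simpa using h.domChart.map_source hy
  have h1 := h.writtenInCharts hy'
  simpa [h.domChart.left_inv hy] using h1

/-- A submersion has a smooth local section through every point. -/
theorem Manifold.IsSubmersion.exists_section {f : M → N}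
    (hf : IsSubmersion 𝓘(ℝ, E) 𝓘(ℝ, E') ∞ f) (x : M) :
    ∃ (σ : N → M) (W : Set N), IsOpen W ∧ f x ∈ W ∧ ContMDiffOn 𝓘(ℝ, E') 𝓘(ℝ, E) ∞ σ W ∧
      σ (f x) = x ∧ ∀ y ∈ W, f (σ y) = y := by
  obtain ⟨φ, hφ, ψ, hψ, L, hx, hm, hn⟩ :=
    (hf.isSubmersionOfComplement_complement x).exists_charts
  -- The section freezes the complementary coordinate at its value at `x`.
  let b := (L (φ x)).2
  let j : E' → E := fun a => L.symm (a, b)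
  have hj : ContDiff ℝ ∞ j := L.symm.contDiff.comp (contDiff_id.prodMk contDiff_const)
  have hjx : j (ψ (f x)) = φ x := by simp [j, b, hn x hx]
  refine ⟨φ.symm ∘ j ∘ ψ, ψ.source ∩ ψ ⁻¹' (j ⁻¹' φ.target),
    ψ.isOpen_inter_preimage (φ.open_target.preimage hj.continuous), ⟨hm hx, ?_⟩, ?_, ?_, ?_⟩
  · simpa [mem_preimage, hjx] using φ.map_source hx
  · exact (contMDiffOn_symm_of_mem_maximalAtlas hφ).comp
      ((hj.contMDiff.comp_contMDiffOn (contMDiffOn_of_mem_maximalAtlas hψ)).mono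
        inter_subset_left) fun y hy => hy.2
  · simp [hjx, φ.left_inv hx]
  · intro y hy
    have h1 : φ.symm (j (ψ y)) ∈ φ.source := φ.map_target hy.2
    refine ψ.injOn (hm h1) hy.1 ?_
    rw [hn _ h1, φ.right_inv hy.2]
    simp [j]

/-- An immersion has a smooth local left inverse. -/
theorem Manifold.IsImmersion.exists_retraction {f : M → N}
    (hf : IsImmersion 𝓘(ℝ, E) 𝓘(ℝ, E') ∞ f) (x : M) :
    ∃ (ρ : N → M), ContMDiffAt 𝓘(ℝ, E') 𝓘(ℝ, E) ∞ ρ (f x) ∧ ∀ᶠ y in 𝓝 x, ρ (f y) = y := by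
  obtain ⟨φ, hφ, ψ, hψ, L, hx, hm, hn⟩ :=
    (hf.isImmersionOfComplement_complement x).exists_charts
  let j : E' → E := fun a => (L.symm a).1
  have hj : ContDiff ℝ ∞ j := contDiff_fst.comp L.symm.contDiff
  have hj' : ∀ y ∈ φ.source, j (ψ (f y)) = φ y := fun y hy => by simp [j, hn y hy]
  refine ⟨φ.symm ∘ j ∘ ψ, ?_, ?_⟩
  · refine ContMDiffAt.comp (I' := 𝓘(ℝ, E)) _ ?_
      (hj.contMDiff.contMDiffAt.comp _ (contMDiffAt_of_mem_maximalAtlas hψ (hm hx)))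
    refine contMDiffAt_symm_of_mem_maximalAtlas hφ ?_
    simpa [hj' x hx] using φ.map_source hx
  · filter_upwards [φ.open_source.mem_nhds hx] with y hy
    simp [hj' y hy, φ.left_inv hy]

/-- A map into an immersed manifold which is continuous, and smooth as a map into the ambient
manifold, is smooth. -/
theorem Manifold.IsImmersion.contMDiffWithinAt_of_comp {f : M → N}
    (hf : IsImmersion 𝓘(ℝ, E) 𝓘(ℝ, E') ∞ f)
    {EY HY Y : Type*} [NormedAddCommGroup EY] [NormedSpace ℝ EY] [TopologicalSpace HY]
    {I : ModelWithCorners ℝ EY HY} [TopologicalSpace Y] [ChartedSpace HY Y]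
    {g : Y → M} {s : Set Y} {y : Y} (hy : y ∈ s) (hc : ContinuousWithinAt g s y)
    (hg : ContMDiffWithinAt I 𝓘(ℝ, E') ∞ (f ∘ g) s y) :
    ContMDiffWithinAt I 𝓘(ℝ, E) ∞ g s y := by
  -- Near `y` the map `g` equals `ρ ∘ f ∘ g`; continuity of `g` is what keeps its values where `ρ`
  -- inverts `f`.
  obtain ⟨ρ, hρ, hρf⟩ := hf.exists_retraction (g y)
  have h := hρ.comp_contMDiffWithinAt y hg
  refine h.congr_of_eventuallyEq_of_mem ?_ hy
  filter_upwards [hc.eventually hρf] with z hz using hz.symm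

/-- The derivative of an immersion is injective. -/
theorem Manifold.IsImmersion.mfderiv_injective {f : M → N}
    (hf : IsImmersion 𝓘(ℝ, E) 𝓘(ℝ, E') ∞ f) (x : M) :
    Function.Injective (mfderiv 𝓘(ℝ, E) 𝓘(ℝ, E') f x) := by
  obtain ⟨ρ, hρ, hρf⟩ := hf.exists_retraction x
  have h1 := (hρ.mdifferentiableAt (by simp)).hasMFDerivAt.comp x
    ((hf.contMDiff x).mdifferentiableAt (by simp)).hasMFDerivAt
  have h2 : HasMFDerivAt 𝓘(ℝ, E) 𝓘(ℝ, E) (ρ ∘ f) x (ContinuousLinearMap.id ℝ _) :=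
    (hasMFDerivAt_id x).congr_of_eventuallyEq hρf
  have h3 := hasMFDerivAt_unique h1 h2
  intro v w hvw
  have h4 := DFunLike.congr_fun h3 v
  have h5 := DFunLike.congr_fun h3 w
  change mfderiv _ _ ρ (f x) (mfderiv _ _ f x v) = v at h4
  change mfderiv _ _ ρ (f x) (mfderiv _ _ f x w) = w at h5
  rw [← h4, ← h5, hvw]

/-- A map with a differentiable local section has surjective derivative. -/
theorem mfderiv_surjective_of_section {f : M → N} {x : M}
    (hf : MDifferentiableAt 𝓘(ℝ, E) 𝓘(ℝ, E') f x) {σ : N → M}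
    (hσ : MDifferentiableAt 𝓘(ℝ, E') 𝓘(ℝ, E) σ (f x)) (hx : σ (f x) = x)
    (hfσ : ∀ᶠ y in 𝓝 (f x), f (σ y) = y) :
    Function.Surjective (mfderiv 𝓘(ℝ, E) 𝓘(ℝ, E') f x) := by
  have hf' : HasMFDerivAt 𝓘(ℝ, E) 𝓘(ℝ, E') f (σ (f x)) (mfderiv 𝓘(ℝ, E) 𝓘(ℝ, E') f x) := by
    rw [hx]
    exact hf.hasMFDerivAt
  have h1 := hf'.comp (f x) hσ.hasMFDerivAt
  have h2 : HasMFDerivAt 𝓘(ℝ, E') 𝓘(ℝ, E') (f ∘ σ) (f x) (ContinuousLinearMap.id ℝ _) :=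
    (hasMFDerivAt_id _).congr_of_eventuallyEq hfσ
  have h3 := hasMFDerivAt_unique h1 h2
  exact fun v => ⟨_, DFunLike.congr_fun h3 v⟩

theorem Manifold.IsSubmersion.mfderiv_surjective {f : M → N}
    (hf : IsSubmersion 𝓘(ℝ, E) 𝓘(ℝ, E') ∞ f) (x : M) :
    Function.Surjective (mfderiv 𝓘(ℝ, E) 𝓘(ℝ, E') f x) := by
  obtain ⟨σ, W, hW, hx, hσ, hσx, hs⟩ := hf.exists_section x
  exact mfderiv_surjective_of_section ((hf.contMDiff x).mdifferentiableAt (by simp))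
    ((hσ.contMDiffAt (hW.mem_nhds hx)).mdifferentiableAt (by simp)) hσx
    (by filter_upwards [hW.mem_nhds hx] using hs)

/-- The derivative of a smooth map written in charts. -/
theorem exists_fderiv_writtenInCharts [IsManifold 𝓘(ℝ, E) ∞ M] [IsManifold 𝓘(ℝ, E') ∞ N]
    {f : M → N} {φ : OpenPartialHomeomorph M E} {ψ : OpenPartialHomeomorph N E'}
    (hφ : φ ∈ maximalAtlas 𝓘(ℝ, E) ∞ M) (hψ : ψ ∈ maximalAtlas 𝓘(ℝ, E') ∞ N) {z : E}
    (hz : z ∈ φ.target) (hfz : f (φ.symm z) ∈ ψ.source)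
    (hf : MDifferentiableAt 𝓘(ℝ, E) 𝓘(ℝ, E') f (φ.symm z)) :
    ∃ (a : E ≃L[ℝ] TangentSpace 𝓘(ℝ, E) (φ.symm z))
      (b : TangentSpace 𝓘(ℝ, E') (f (φ.symm z)) ≃L[ℝ] E'),
      ∀ v, fderiv ℝ (ψ ∘ f ∘ φ.symm) z v = b (mfderiv 𝓘(ℝ, E) 𝓘(ℝ, E') f (φ.symm z) (a v)) := by
  have h1 : φ.MDifferentiable 𝓘(ℝ, E) 𝓘(ℝ, E) :=
    ⟨(contMDiffOn_of_mem_maximalAtlas hφ).mdifferentiableOn (by simp),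
      (contMDiffOn_symm_of_mem_maximalAtlas hφ).mdifferentiableOn (by simp)⟩
  have h2 : ψ.MDifferentiable 𝓘(ℝ, E') 𝓘(ℝ, E') :=
    ⟨(contMDiffOn_of_mem_maximalAtlas hψ).mdifferentiableOn (by simp),
      (contMDiffOn_symm_of_mem_maximalAtlas hψ).mdifferentiableOn (by simp)⟩
  refine ⟨h1.symm.mfderiv hz, h2.mfderiv hfz, fun v => ?_⟩
  have h3 := (h2.mdifferentiableAt hfz).hasMFDerivAt.comp z
    (hf.hasMFDerivAt.comp z (h1.mdifferentiableAt_symm hz).hasMFDerivAt)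
  have h4 := h3.mfderiv
  rw [mfderiv_eq_fderiv] at h4
  exact DFunLike.congr_fun h4 v

theorem contDiffOn_writtenInCharts {f : M → N} {φ : OpenPartialHomeomorph M E}
    {ψ : OpenPartialHomeomorph N E'}
    (hφ : φ ∈ maximalAtlas 𝓘(ℝ, E) ∞ M) (hψ : ψ ∈ maximalAtlas 𝓘(ℝ, E') ∞ N)
    [IsManifold 𝓘(ℝ, E) ∞ M] [IsManifold 𝓘(ℝ, E') ∞ N]
    (hf : ContMDiff 𝓘(ℝ, E) 𝓘(ℝ, E') ∞ f) :
    ContDiffOn ℝ ∞ (ψ ∘ f ∘ φ.symm) (φ.target ∩ φ.symm ⁻¹' (f ⁻¹' ψ.source)) := by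
  refine ContMDiffOn.contDiffOn ?_
  exact (contMDiffOn_of_mem_maximalAtlas hψ).comp
    ((hf.comp_contMDiffOn (contMDiffOn_symm_of_mem_maximalAtlas hφ)).mono inter_subset_left)
    fun y hy => hy.2

/-- A smooth map between finite-dimensional manifolds with surjective derivatives is a
submersion. -/
theorem isSubmersion_of_mfderiv_surjective [FiniteDimensional ℝ E] [FiniteDimensional ℝ E']
    [IsManifold 𝓘(ℝ, E) ∞ M] [IsManifold 𝓘(ℝ, E') ∞ N] {f : M → N}
    (hf : ContMDiff 𝓘(ℝ, E) 𝓘(ℝ, E') ∞ f)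
    (hs : ∀ x, Function.Surjective (mfderiv 𝓘(ℝ, E) 𝓘(ℝ, E') f x)) :
    IsSubmersion 𝓘(ℝ, E) 𝓘(ℝ, E') ∞ f := by
  let K := EuclideanSpace ℝ (Fin (Module.finrank ℝ E - Module.finrank ℝ E'))
  have key : IsSubmersionOfComplement K 𝓘(ℝ, E) 𝓘(ℝ, E') ∞ f := by
    intro x
    let φ := chartAt E x
    let ψ := chartAt E' (f x)
    have hφ : φ ∈ maximalAtlas 𝓘(ℝ, E) ∞ M := chart_mem_maximalAtlas x
    have hψ : ψ ∈ maximalAtlas 𝓘(ℝ, E') ∞ N := chart_mem_maximalAtlas (f x)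
    have hx : x ∈ φ.source := mem_chart_source E x
    have hfx : f x ∈ ψ.source := mem_chart_source E' (f x)
    let U := φ.target ∩ φ.symm ⁻¹' (f ⁻¹' ψ.source)
    have hU : IsOpen U :=
      φ.symm.isOpen_inter_preimage (ψ.open_source.preimage hf.continuous)
    have hp : ContDiffOn ℝ ∞ (ψ ∘ f ∘ φ.symm) U := contDiffOn_writtenInCharts hφ hψ hf
    have hxU : φ x ∈ U := ⟨φ.map_source hx, by simpa [φ.left_inv hx] using hfx⟩
    obtain ⟨a, b, hab⟩ := exists_fderiv_writtenInCharts hφ hψ hxU.1 hxU.2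
      ((hf _).mdifferentiableAt (by simp))
    have hsurj : Function.Surjective (fderiv ℝ (ψ ∘ f ∘ φ.symm) (φ x)) := by
      have : ⇑(fderiv ℝ (ψ ∘ f ∘ φ.symm) (φ x)) = b ∘ _ ∘ a := funext hab
      rw [this]
      exact b.surjective.comp ((hs _).comp a.surjective)
    have hle : Module.finrank ℝ E' ≤ Module.finrank ℝ E :=
      LinearMap.finrank_le_finrank_of_surjective (f := (fderiv ℝ (ψ ∘ f ∘ φ.symm) (φ x) :
        E →ₗ[ℝ] E')) hsurj
    have hd : Module.finrank ℝ E' + Module.finrank ℝ K = Module.finrank ℝ E := by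
      simp only [K, finrank_euclideanSpace_fin]
      omega
    obtain ⟨Φ, h1, h2, h3, h4, h5⟩ := hp.exists_straightening (K := K) hU hxU hsurj hd
    -- Charts must take values in `E`, so the straightened coordinates are carried there by an
    -- arbitrary isomorphism, whose inverse is the required splitting.
    have L : (E' × K) ≃L[ℝ] E := ContinuousLinearEquiv.ofFinrankEq (by simpa using hd)
    refine IsSubmersionAtOfComplement.mk_of_charts L.symm
      (φ.trans (Φ.trans L.toHomeomorph.toOpenPartialHomeomorph)) ψ ⟨hx, h1, trivial⟩ hfx
      (trans_mem_maximalAtlas hφ h4 h5 L) hψ ?_ ?_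
    · intro y hy
      have h6 := (h2 hy.2.1).2
      have hy1 : y ∈ φ.source := hy.1
      simpa [φ.left_inv hy1] using h6
    · intro z hz
      have hz' : L.symm z ∈ Φ.target := by
        have := hz
        simp only [mfld_simps] at this
        exact this.1
      have h6 := h3 (Φ.symm (L.symm z))
      rw [Φ.right_inv hz'] at h6
      simp only [mfld_simps, Function.comp_apply]
      exact h6.symm
  exact key.isSubmersion

/-- A smooth map with a smooth local section through every point is a submersion. -/
theorem isSubmersion_of_sections [FiniteDimensional ℝ E] [FiniteDimensional ℝ E']
    [IsManifold 𝓘(ℝ, E) ∞ M] [IsManifold 𝓘(ℝ, E') ∞ N] {f : M → N}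
    (hf : ContMDiff 𝓘(ℝ, E) 𝓘(ℝ, E') ∞ f)
    (hs : ∀ x, ∃ σ : N → M, ContMDiffAt 𝓘(ℝ, E') 𝓘(ℝ, E) ∞ σ (f x) ∧ σ (f x) = x ∧
      ∀ᶠ y in 𝓝 (f x), f (σ y) = y) :
    IsSubmersion 𝓘(ℝ, E) 𝓘(ℝ, E') ∞ f := by
  refine isSubmersion_of_mfderiv_surjective hf fun x => ?_
  obtain ⟨σ, h1, h2, h3⟩ := hs x
  exact mfderiv_surjective_of_section ((hf x).mdifferentiableAt (by simp))
    (h1.mdifferentiableAt (by simp)) h2 h3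

/-- The constant rank theorem for maps between manifolds. -/
theorem exists_constant_rank_charts [FiniteDimensional ℝ E] [FiniteDimensional ℝ E']
    [FiniteDimensional ℝ A] [FiniteDimensional ℝ K] [FiniteDimensional ℝ C]
    [IsManifold 𝓘(ℝ, E) ∞ M] [IsManifold 𝓘(ℝ, E') ∞ N] {f : M → N}
    (hf : ContMDiff 𝓘(ℝ, E) 𝓘(ℝ, E') ∞ f)
    (hr : ∀ x, Module.finrank ℝ (mfderiv 𝓘(ℝ, E) 𝓘(ℝ, E') f x).range = Module.finrank ℝ A)
    (hE : Module.finrank ℝ A + Module.finrank ℝ K = Module.finrank ℝ E)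
    (hF : Module.finrank ℝ A + Module.finrank ℝ C = Module.finrank ℝ E') (x : M) :
    ∃ φ ∈ maximalAtlas 𝓘(ℝ, E) ∞ M, ∃ ψ ∈ maximalAtlas 𝓘(ℝ, E') ∞ N,
      ∃ (L : E ≃L[ℝ] A × K) (L' : (A × C) ≃L[ℝ] E'),
      x ∈ φ.source ∧ MapsTo f φ.source ψ.source ∧
        ∀ y ∈ φ.source, ψ (f y) = L' ((L (φ y)).1, 0) := by
  let φ := chartAt E x
  let ψ := chartAt E' (f x)
  have hφ : φ ∈ maximalAtlas 𝓘(ℝ, E) ∞ M := chart_mem_maximalAtlas x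
  have hψ : ψ ∈ maximalAtlas 𝓘(ℝ, E') ∞ N := chart_mem_maximalAtlas (f x)
  have hx : x ∈ φ.source := mem_chart_source E x
  have hfx : f x ∈ ψ.source := mem_chart_source E' (f x)
  let U := φ.target ∩ φ.symm ⁻¹' (f ⁻¹' ψ.source)
  have hU : IsOpen U :=
    φ.symm.isOpen_inter_preimage (ψ.open_source.preimage hf.continuous)
  have hp : ContDiffOn ℝ ∞ (ψ ∘ f ∘ φ.symm) U := contDiffOn_writtenInCharts hφ hψ hf
  have hxU : φ x ∈ U := ⟨φ.map_source hx, by simpa [φ.left_inv hx] using hfx⟩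
  have hrank : ∀ z ∈ U, Module.finrank ℝ (fderiv ℝ (ψ ∘ f ∘ φ.symm) z).range =
      Module.finrank ℝ A := by
    intro z hz
    obtain ⟨a, b, hab⟩ := exists_fderiv_writtenInCharts hφ hψ hz.1 hz.2
      ((hf _).mdifferentiableAt (by simp))
    rw [← hr (φ.symm z)]
    have h1 : (fderiv ℝ (ψ ∘ f ∘ φ.symm) z).range =
        (mfderiv 𝓘(ℝ, E) 𝓘(ℝ, E') f (φ.symm z)).range.map (b.toLinearEquiv : _ →ₗ[ℝ] E') := by
      ext w
      constructor
      · rintro ⟨v, rfl⟩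
        exact ⟨_, ⟨a v, rfl⟩, (hab v).symm⟩
      · rintro ⟨_, ⟨v, rfl⟩, rfl⟩
        exact ⟨a.symm v, (hab _).trans (by rw [a.apply_symm_apply]; rfl)⟩
    rw [h1]
    exact LinearEquiv.finrank_map_eq b.toLinearEquiv _
  obtain ⟨Φ, Ψ, h1, h2, h3, h4, h5, h6, h7, h8⟩ :=
    hp.exists_constant_rank_form (K := K) (C := C) hU hxU hrank hE hF
  have L : (A × K) ≃L[ℝ] E := ContinuousLinearEquiv.ofFinrankEq (by simpa using hE)
  have L' : (A × C) ≃L[ℝ] E' := ContinuousLinearEquiv.ofFinrankEq (by simpa using hF)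
  refine ⟨_, trans_mem_maximalAtlas hφ h5 h6 L, _, trans_mem_maximalAtlas hψ h7 h8 L',
    L.symm, L', ⟨hx, h1, trivial⟩, ?_, ?_⟩
  · intro y hy
    have hy1 : φ.symm (φ y) = y := φ.left_inv hy.1
    have hy2 : φ y ∈ Φ.source := hy.2.1
    have h9 : f (φ.symm (φ y)) ∈ ψ.source := (h2 hy2).2
    have h10 : ψ (f (φ.symm (φ y))) ∈ Ψ.source := h3 hy2
    rw [hy1] at h9 h10
    exact ⟨h9, h10, trivial⟩
  · intro y hy
    have hy1 : φ.symm (φ y) = y := φ.left_inv hy.1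
    have hy2 : φ y ∈ Φ.source := hy.2.1
    have h9 : Ψ (ψ (f (φ.symm (φ y)))) = ((Φ (φ y)).1, 0) := h4 _ hy2
    rw [hy1] at h9
    change L' (Ψ (ψ (f y))) = L' ((L.symm (L (Φ (φ y)))).1, 0)
    rw [h9, L.symm_apply_apply]

/-- The charts of a space mapped into a manifold in which the map becomes the inclusion of a
linear subspace. -/
def sliceCharts {X : Type*} [TopologicalSpace X] (A C : Type*) [NormedAddCommGroup A]
    [NormedSpace ℝ A] [NormedAddCommGroup C] [NormedSpace ℝ C] (ι : X → N) :
    Set (OpenPartialHomeomorph X A) :=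
  {e | ∃ ψ ∈ maximalAtlas 𝓘(ℝ, E') ∞ N, ∃ L : (A × C) ≃L[ℝ] E',
    MapsTo ι e.source ψ.source ∧ ∀ y ∈ e.source, ψ (ι y) = L (e y, 0)}

/-- A space covered by slice charts is an immersed manifold. -/
theorem exists_chartedSpace_of_sliceCharts {X : Type*} [TopologicalSpace X]
    [IsManifold 𝓘(ℝ, E') ∞ N] {ι : X → N}
    (hcov : ∀ x, ∃ e ∈ sliceCharts (E' := E') A C ι, x ∈ e.source) :
    ∃ _ : ChartedSpace A X, IsManifold 𝓘(ℝ, A) ∞ X ∧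
      IsImmersion 𝓘(ℝ, A) 𝓘(ℝ, E') ∞ ι ∧
      sliceCharts (E' := E') A C ι ⊆ maximalAtlas 𝓘(ℝ, A) ∞ X := by
  choose e he hx using hcov
  let cs : ChartedSpace A X :=
    -- All slice charts are admitted, so each one lies in the maximal atlas by construction, not
    -- only the chosen ones.
    { atlas := sliceCharts (E' := E') A C ι
      chartAt := e
      mem_chart_source := hx
      chart_mem_atlas := he }
  have hman : IsManifold 𝓘(ℝ, A) ∞ X := by
    refine isManifold_of_contDiffOn _ _ _ ?_
    rintro e₁ e₂ ⟨ψ₁, hψ₁, L₁, hm₁, hn₁⟩ ⟨ψ₂, hψ₂, L₂, hm₂, hn₂⟩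
    -- This formula, in which only ambient charts occur, is the transition map: both slice charts
    -- read off coordinates of the same point of `N`.
    have h1 : ContDiffOn ℝ ∞ (fun a => (L₂.symm (ψ₂ (ψ₁.symm (L₁ (a, 0))))).1)
        {a | L₁ (a, 0) ∈ ψ₁.target ∧ ψ₁.symm (L₁ (a, 0)) ∈ ψ₂.source} := by
      have h2 : ContDiffOn ℝ ∞ (ψ₂ ∘ ψ₁.symm) (ψ₁.target ∩ ψ₁.symm ⁻¹' ψ₂.source) :=
        ContMDiffOn.contDiffOn ((contMDiffOn_of_mem_maximalAtlas hψ₂).comp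
          ((contMDiffOn_symm_of_mem_maximalAtlas hψ₁).mono inter_subset_left) fun y hy => hy.2)
      exact (contDiff_fst.comp L₂.symm.contDiff).comp_contDiffOn
        (h2.comp (L₁.contDiff.comp (contDiff_id.prodMk contDiff_const)).contDiffOn fun a ha => ha)
    have h3 : ∀ a ∈ (e₁.symm ≫ₕ e₂).source, L₁ (a, 0) = ψ₁ (ι (e₁.symm a)) := by
      intro a ha
      rw [hn₁ _ (e₁.map_target ha.1), e₁.right_inv ha.1]
    have h4 : ∀ a ∈ (e₁.symm ≫ₕ e₂).source, ψ₁.symm (L₁ (a, 0)) = ι (e₁.symm a) := by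
      intro a ha
      rw [h3 a ha, ψ₁.left_inv (hm₁ (e₁.map_target ha.1))]
    simp only [modelWithCornersSelf_coe, modelWithCornersSelf_coe_symm, Function.id_comp,
      Function.comp_id, preimage_id, range_id, inter_univ]
    refine (h1.mono ?_).congr ?_
    · intro a ha
      refine ⟨?_, ?_⟩
      · rw [h3 a ha]
        exact ψ₁.map_source (hm₁ (e₁.map_target ha.1))
      · rw [h4 a ha]
        exact hm₂ ha.2
    · intro a ha
      have h5 : e₁.symm a ∈ e₂.source := ha.2
      rw [h4 a ha, hn₂ _ h5]
      simp
  have hmem : sliceCharts (E' := E') A C ι ⊆ maximalAtlas 𝓘(ℝ, A) ∞ X := fun e he =>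
    subset_maximalAtlas he
  refine ⟨cs, hman, ?_, hmem⟩
  refine IsImmersionOfComplement.isImmersion (F := C) fun x => ?_
  obtain ⟨ψ, hψ, L, hm, hn⟩ := he x
  refine IsImmersionAtOfComplement.mk_of_charts L (e x) ψ (hx x) (hm (hx x)) (hmem (he x)) hψ
    hm ?_
  intro a ha
  have ha' : a ∈ (e x).target := by simpa only [mfld_simps] using ha
  have h1 := hn _ ((e x).map_target ha')
  rw [(e x).right_inv ha'] at h1
  simpa only [mfld_simps, Function.comp_apply] using h1

end Manifolds

/-! ### Fibres of submersions -/

section Fibres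

open Set Filter Topology IsManifold

/-- The fibres of a submersion are embedded submanifolds. -/
theorem Manifold.IsSubmersion.exists_chartedSpace_fibre {n m : ℕ} {M N : Type*}
    [TopologicalSpace M] [ChartedSpace (EuclideanSpace ℝ (Fin n)) M] [IsManifold (𝓡 n) ∞ M]
    [TopologicalSpace N] [ChartedSpace (EuclideanSpace ℝ (Fin m)) N] [IsManifold (𝓡 m) ∞ N]
    {f : M → N} (hf : IsSubmersion (𝓡 n) (𝓡 m) ∞ f) {c : N} (hc : ∃ y, f y = c) :
    ∃ (d : ℕ) (_ : ChartedSpace (EuclideanSpace ℝ (Fin d)) {y // f y = c}),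
      m + d = n ∧ IsManifold (𝓡 d) ∞ {y // f y = c} ∧
        IsSmoothEmbedding (𝓡 d) (𝓡 n) ∞ (Subtype.val : {y // f y = c} → M) := by
  obtain ⟨y₀, hy₀⟩ := hc
  have hle : m ≤ n := by
    have := LinearMap.finrank_le_finrank_of_surjective (R := ℝ)
      (f := (show EuclideanSpace ℝ (Fin n) →L[ℝ] EuclideanSpace ℝ (Fin m) from
        mfderiv (𝓡 n) (𝓡 m) f y₀).toLinearMap) (hf.mfderiv_surjective y₀)
    simpa using this
  obtain ⟨d, rfl⟩ := Nat.exists_eq_add_of_le hle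
  have hcov : ∀ y : {y // f y = c}, ∃ e ∈ sliceCharts (E' := EuclideanSpace ℝ (Fin (m + d)))
      (EuclideanSpace ℝ (Fin d)) (EuclideanSpace ℝ (Fin m)) (Subtype.val : {y // f y = c} → M),
      y ∈ e.source := by
    rintro ⟨y, hy⟩
    obtain ⟨φ, hφ, ψ, hψ, L, hyφ, hm, hn⟩ :=
      (hf.isSubmersionOfComplement_complement y).exists_charts
    have hcψ : c ∈ ψ.source := hy ▸ hm hyφ
    have : FiniteDimensional ℝ hf.complement := by
      refine FiniteDimensional.of_surjective
        ((LinearMap.snd ℝ _ _).comp L.toLinearEquiv.toLinearMap) ?_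
      exact Prod.snd_surjective.comp L.surjective
    have hfin : Module.finrank ℝ hf.complement = Module.finrank ℝ (EuclideanSpace ℝ (Fin d)) := by
      have := L.toLinearEquiv.finrank_eq
      simp only [Module.finrank_prod, finrank_euclideanSpace_fin] at this ⊢
      omega
    let eF : hf.complement ≃L[ℝ] EuclideanSpace ℝ (Fin d) :=
      ContinuousLinearEquiv.ofFinrankEq hfin
    let j : EuclideanSpace ℝ (Fin d) → EuclideanSpace ℝ (Fin (m + d)) :=
      fun b => L.symm (ψ c, eF.symm b)
    have hj : Continuous j := by fun_prop
    have hjf : ∀ b, j b ∈ φ.target → f (φ.symm (j b)) = c := by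
      intro b hb
      have h1 := φ.map_target hb
      refine ψ.injOn (hm h1) hcψ ?_
      rw [hn _ h1, φ.right_inv hb]
      simp [j]
    have hjφ : ∀ z : {y // f y = c}, z.1 ∈ φ.source → j (eF (L (φ z.1)).2) = φ z.1 := by
      intro z hz
      have h1 := hn _ hz
      rw [z.2] at h1
      simp only [j, eF.symm_apply_apply]
      rw [h1]
      simp
    classical
    let e : OpenPartialHomeomorph {y // f y = c} (EuclideanSpace ℝ (Fin d)) :=
      { toFun := fun z => eF (L (φ z.1)).2
        -- The default value plays no role: by `hjf` every point of the target parametrises a point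
        -- of the fibre.
        invFun := fun b => if h : f (φ.symm (j b)) = c then ⟨φ.symm (j b), h⟩ else ⟨y, hy⟩
        source := {z | z.1 ∈ φ.source}
        target := {b | j b ∈ φ.target}
        map_source' := fun z hz => by
          simp only [mem_ofPred_eq]
          rw [hjφ z hz]
          exact φ.map_source hz
        map_target' := fun b hb => by
          simp only [mem_ofPred_eq, dif_pos (hjf b hb)]
          exact φ.map_target hb
        left_inv' := fun z hz => by
          have h1 : φ.symm (j (eF (L (φ z.1)).2)) = z.1 := by rw [hjφ z hz, φ.left_inv hz]
          rw [dif_pos (by rw [h1, z.2])]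
          exact Subtype.ext h1
        right_inv' := fun b hb => by
          simp only [dif_pos (hjf b hb)]
          rw [φ.right_inv hb]
          simp [j]
        open_source := φ.open_source.preimage continuous_subtype_val
        open_target := φ.open_target.preimage hj
        continuousOn_toFun := by
          refine Continuous.comp_continuousOn (g := fun a => eF (L a).2) (by fun_prop) ?_
          exact φ.continuousOn.comp continuous_subtype_val.continuousOn fun z hz => hz
        continuousOn_invFun := by
          refine (IsInducing.subtypeVal (t := {y | f y = c})).continuousOn_iff.2 ?_
          refine (φ.continuousOn_symm.comp hj.continuousOn fun b hb => hb).congr ?_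
          intro b hb
          simp only [Function.comp_apply, dif_pos (hjf b hb)] }
    -- In `φ` the fibre is an affine subspace with first coordinate `ψ c`; slice charts ask for a
    -- linear one, hence the translation by `-w`.
    let w : EuclideanSpace ℝ (Fin (m + d)) := L.symm (ψ c, 0)
    let T : OpenPartialHomeomorph (EuclideanSpace ℝ (Fin (m + d)))
      (EuclideanSpace ℝ (Fin (m + d))) := (Homeomorph.addRight (-w)).toOpenPartialHomeomorph
    have hT := trans_mem_maximalAtlas hφ (Φ := T) (A := EuclideanSpace ℝ (Fin (m + d)))
      (contDiff_id.add contDiff_const).contDiffOn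
      (contDiff_id.add contDiff_const).contDiffOn (ContinuousLinearEquiv.refl ℝ _)
    refine ⟨e, ⟨_, hT, (ContinuousLinearEquiv.prodComm ℝ _ _).trans
      (((ContinuousLinearEquiv.refl ℝ _).prodCongr eF.symm).trans L.symm),
      fun z hz => ⟨hz, trivial, trivial⟩, fun z hz => ?_⟩, hyφ⟩
    change φ z.1 + -w = L.symm (0, eF.symm (eF (L (φ z.1)).2))
    rw [eF.symm_apply_apply, ← sub_eq_add_neg, sub_eq_iff_eq_add, ← map_add, Prod.mk_add_mk,
      zero_add, add_zero]
    have h1 := hn _ hz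
    rw [z.2] at h1
    rw [h1]
    exact (L.symm_apply_apply _).symm
  obtain ⟨cs, h1, h2, -⟩ := exists_chartedSpace_of_sliceCharts hcov
  exact ⟨d, cs, rfl, h1, h2, IsEmbedding.subtypeVal⟩

end Fibres

/-! ### Orbits of smooth groupoids -/

namespace Grpd

open Set Filter Topology IsManifold

theorem toOrbit_surjective {G : Type u} {M : Type v} (A : Grpd G M) (x : M) :
    Function.Surjective (A.toOrbit x) := by
  rintro ⟨_, g, hg, rfl⟩
  exact ⟨⟨g, hg⟩, rfl⟩

variable {G : Type u} {M : Type v} {n m : ℕ}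
  [TopologicalSpace G] [ChartedSpace (EuclideanSpace ℝ (Fin n)) G] [IsManifold (𝓡 n) ∞ G]
  [TopologicalSpace M] [ChartedSpace (EuclideanSpace ℝ (Fin m)) M] [IsManifold (𝓡 m) ∞ M]
  {A : Grpd G M}

theorem IsSmooth.mul_continuousOn (hA : A.IsSmooth n m) :
    ContinuousOn (fun p : G × G => A.mul p.1 p.2) {p : G × G | A.src p.1 = A.tgt p.2} :=
  hA.mul_smooth.continuousOn

/-- Multiplication is smooth only within the set of composable pairs; composability near `y` makes
the preimage of that set a neighbourhood, so nothing is lost. -/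
theorem IsSmooth.contMDiffAt_mul (hA : A.IsSmooth n m) {EY HY Y : Type*}
    [NormedAddCommGroup EY] [NormedSpace ℝ EY] [TopologicalSpace HY]
    {I : ModelWithCorners ℝ EY HY} [TopologicalSpace Y] [ChartedSpace HY Y]
    {a b : Y → G} {y : Y} (ha : ContMDiffAt I (𝓡 n) ∞ a y) (hb : ContMDiffAt I (𝓡 n) ∞ b y)
    (hab : ∀ᶠ z in 𝓝 y, A.src (a z) = A.tgt (b z)) :
    ContMDiffAt I (𝓡 n) ∞ (fun z => A.mul (a z) (b z)) y := by
  let V : Set Y := {z | A.src (a z) = A.tgt (b z)}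
  have h1 := hA.mul_smooth (a y, b y) hab.self_of_nhds
  have h2 : ContMDiffWithinAt I ((𝓡 n).prod (𝓡 n)) ∞ (fun z => (a z, b z)) V y :=
    (ha.prodMk hb).contMDiffWithinAt
  exact (ContMDiffWithinAt.comp (f := fun z => (a z, b z)) y h1 h2
    fun z hz => hz).contMDiffAt hab

/-- For a local section `ρ` of the source through a unit, the map `k ↦ ρ (t k) k` has a derivative
which is the identity on the kernel of the derivative of the target. -/
theorem IsSmooth.hasMFDerivAt_mul_section (hA : A.IsSmooth n m) {h : G} {ρ : M → G}
    (hρ : MDifferentiableAt (𝓡 m) (𝓡 n) ρ (A.tgt h)) (hρu : ρ (A.tgt h) = A.unit (A.tgt h))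
    (hρs : ∀ᶠ y in 𝓝 (A.tgt h), A.src (ρ y) = y) :
    ∃ D : TangentSpace (𝓡 n) h →L[ℝ] TangentSpace (𝓡 n) h,
      HasMFDerivAt (𝓡 n) (𝓡 n) (fun k => A.mul (ρ (A.tgt k)) k) h D ∧
      ∀ v, mfderiv (𝓡 n) (𝓡 m) A.tgt h v = 0 → D v = v := by
  let S : Set (G × G) := {p : G × G | A.src p.1 = A.tgt p.2}
  have hp : (A.unit (A.tgt h), h) ∈ S := A.src_unit _
  -- Derivatives within the set of composable pairs need not be unique, so one is fixed and used for
  -- both `ρ` and the unit section.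
  obtain ⟨m', hm'⟩ : ∃ m', HasMFDerivWithinAt ((𝓡 n).prod (𝓡 n)) (𝓡 n)
      (fun p : G × G => A.mul p.1 p.2) S (A.unit (A.tgt h), h) m' :=
    ⟨_, ((hA.mul_smooth _ hp).mdifferentiableWithinAt (by simp)).hasMFDerivWithinAt⟩
  have ht : HasMFDerivAt (𝓡 n) (𝓡 m) A.tgt h (mfderiv (𝓡 n) (𝓡 m) A.tgt h) :=
    ((hA.tgt_smooth h).mdifferentiableAt (by simp)).hasMFDerivAt
  have key : ∀ ρ : M → G, MDifferentiableAt (𝓡 m) (𝓡 n) ρ (A.tgt h) →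
      ρ (A.tgt h) = A.unit (A.tgt h) → (∀ᶠ y in 𝓝 (A.tgt h), A.src (ρ y) = y) →
      ∃ D : TangentSpace (𝓡 n) h →L[ℝ] TangentSpace (𝓡 n) h,
        HasMFDerivAt (𝓡 n) (𝓡 n) (fun k => A.mul (ρ (A.tgt k)) k) h D ∧
        ∀ v, mfderiv (𝓡 n) (𝓡 m) A.tgt h v = 0 → D v = m' (0, v) := by
    intro ρ hρ hρu hρs
    have h1 := (hρ.hasMFDerivAt.comp h ht).prodMk (hasMFDerivAt_id h)
    let V : Set G := {k | A.src (ρ (A.tgt k)) = A.tgt k}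
    have hV : V ∈ 𝓝 h := (hA.tgt_smooth.continuous.tendsto h).eventually hρs
    have h2 : HasMFDerivWithinAt ((𝓡 n).prod (𝓡 n)) (𝓡 n)
        (fun p : G × G => A.mul p.1 p.2) S ((ρ ∘ A.tgt) h, id h) m' := by
      rw [Function.comp_apply, hρu]
      exact hm'
    have h3 := HasMFDerivWithinAt.comp (f := fun k => ((ρ ∘ A.tgt) k, id k)) h h2
      (h1.hasMFDerivWithinAt (s := V)) fun k hk => hk
    refine ⟨_, h3.hasMFDerivAt hV, fun v hv => ?_⟩
    change m' (mfderiv (𝓡 m) (𝓡 n) ρ (A.tgt h) (mfderiv (𝓡 n) (𝓡 m) A.tgt h v), v) = _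
    rw [hv, map_zero]
    rfl
  obtain ⟨D, hD, hDv⟩ := key ρ hρ hρu hρs
  -- For the unit section the map is the identity, which determines `m' (0, v)`.
  obtain ⟨D', hD', hDv'⟩ := key A.unit ((hA.unit_smooth _).mdifferentiableAt (by simp)) rfl
    (Eventually.of_forall fun y => A.src_unit y)
  refine ⟨D, hD, fun v hv => ?_⟩
  rw [hDv v hv, ← hDv' v hv]
  have h1 : (fun k => A.mul (A.unit (A.tgt k)) k) = id := funext A.unit_mul
  rw [h1] at hD'
  exact DFunLike.congr_fun (hasMFDerivAt_unique hD' (hasMFDerivAt_id h)) v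

/-- The tangent space at `h` to the set of arrows with the same source and target as `h`. -/
noncomputable def isotropyTangent (n m : ℕ)
    [ChartedSpace (EuclideanSpace ℝ (Fin n)) G] [ChartedSpace (EuclideanSpace ℝ (Fin m)) M]
    (A : Grpd G M) (h : G) : Submodule ℝ (EuclideanSpace ℝ (Fin n)) :=
  (mfderiv (𝓡 n) (𝓡 m) A.src h).ker ⊓ (mfderiv (𝓡 n) (𝓡 m) A.tgt h).ker

/-- With c = h₂h₁⁻¹ and `σ` a local section of the source through c, the map k ↦ σ(t k)k sends h₁ to
h₂ and preserves sources, and its target depends on t k alone; so its derivative respects the two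
kernels. A section through c⁻¹ gives injectivity there. The section need not be a bisection.
Exchanging h₁ and h₂ gives equality. -/
theorem IsSmooth.finrank_isotropyTangent_le (hA : A.IsSmooth n m) {h₁ h₂ : G}
    (hs : A.src h₁ = A.src h₂) :
    Module.finrank ℝ (A.isotropyTangent n m h₁) ≤ Module.finrank ℝ (A.isotropyTangent n m h₂) := by
  have hst : A.src h₂ = A.tgt (A.inv h₁) := by rw [A.tgt_inv, hs]
  set c := A.mul h₂ (A.inv h₁) with hcdef
  have hcs : A.src c = A.tgt h₁ := by rw [A.src_mul _ _ hst, A.src_inv]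
  have hct : A.tgt c = A.tgt h₂ := A.tgt_mul _ _ hst
  have hch : A.mul c h₁ = h₂ := by
    rw [hcdef, A.mul_assoc _ _ _ hst (A.src_inv _), A.inv_mul, hs, A.mul_unit]
  obtain ⟨σ, W, hW, hcW, hσ, hσc, hσs⟩ := hA.src_submersion.exists_section c
  obtain ⟨σ', W', hW', hcW', hσ', hσc', hσs'⟩ := hA.src_submersion.exists_section (A.inv c)
  rw [hcs] at hcW hσc
  rw [A.src_inv, hct] at hcW' hσc'
  have hσat : ContMDiffAt (𝓡 m) (𝓡 n) ∞ σ (A.tgt h₁) := hσ.contMDiffAt (hW.mem_nhds hcW)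
  have hσat' : ContMDiffAt (𝓡 m) (𝓡 n) ∞ σ' (A.tgt h₂) := hσ'.contMDiffAt (hW'.mem_nhds hcW')
  have ev : ∀ᶠ y in 𝓝 (A.tgt h₁), A.src (σ y) = y := by
    filter_upwards [hW.mem_nhds hcW] using hσs
  have ev' : ∀ᶠ y in 𝓝 (A.tgt h₂), A.src (σ' y) = y := by
    filter_upwards [hW'.mem_nhds hcW'] using hσs'
  have ht : ∀ h, Tendsto A.tgt (𝓝 h) (𝓝 (A.tgt h)) := hA.tgt_smooth.continuous.tendsto
  let lam : G → G := fun k => A.mul (σ (A.tgt k)) k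
  let mu : G → G := fun k => A.mul (σ' (A.tgt k)) k
  have hlam : ContMDiffAt (𝓡 n) (𝓡 n) ∞ lam h₁ :=
    hA.contMDiffAt_mul (ContMDiffAt.comp h₁ hσat (hA.tgt_smooth h₁)) contMDiffAt_id
      ((ht h₁).eventually ev)
  have hlam₁ : lam h₁ = h₂ := by simp only [lam]; rw [hσc, hch]
  have hmu : ContMDiffAt (𝓡 n) (𝓡 n) ∞ mu (lam h₁) := by
    rw [hlam₁]
    exact hA.contMDiffAt_mul (ContMDiffAt.comp h₂ hσat' (hA.tgt_smooth h₂)) contMDiffAt_id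
      ((ht h₂).eventually ev')
  have hdlam := (hlam.mdifferentiableAt (by simp)).hasMFDerivAt
  have hdmu := (hmu.mdifferentiableAt (by simp)).hasMFDerivAt
  set Dl := mfderiv (𝓡 n) (𝓡 n) lam h₁
  -- source and target of `lam k`
  have hsl : ∀ᶠ k in 𝓝 h₁, A.src (lam k) = A.src k := by
    filter_upwards [(ht h₁).eventually ev] with k hk using A.src_mul _ _ hk
  have htl : ∀ᶠ k in 𝓝 h₁, A.tgt (lam k) = A.tgt (σ (A.tgt k)) := by
    filter_upwards [(ht h₁).eventually ev] with k hk using A.tgt_mul _ _ hk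
  have hds : ∀ v, mfderiv (𝓡 n) (𝓡 m) A.src h₂ (Dl v) = mfderiv (𝓡 n) (𝓡 m) A.src h₁ v := by
    intro v
    have h1 : HasMFDerivAt (𝓡 n) (𝓡 m) A.src (lam h₁) (mfderiv (𝓡 n) (𝓡 m) A.src h₂) := by
      rw [hlam₁]
      exact ((hA.src_submersion.contMDiff _).mdifferentiableAt (by simp)).hasMFDerivAt
    have h2 : HasMFDerivAt (𝓡 n) (𝓡 m) (A.src ∘ lam) h₁ (mfderiv (𝓡 n) (𝓡 m) A.src h₁) :=
      ((hA.src_submersion.contMDiff _).mdifferentiableAt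
        (by simp)).hasMFDerivAt.congr_of_eventuallyEq hsl
    exact DFunLike.congr_fun (hasMFDerivAt_unique (h1.comp h₁ hdlam) h2) v
  have hdt : ∀ v, mfderiv (𝓡 n) (𝓡 m) A.tgt h₁ v = 0 →
      mfderiv (𝓡 n) (𝓡 m) A.tgt h₂ (Dl v) = 0 := by
    intro v hv
    have h1 : HasMFDerivAt (𝓡 n) (𝓡 m) A.tgt (lam h₁) (mfderiv (𝓡 n) (𝓡 m) A.tgt h₂) := by
      rw [hlam₁]
      exact ((hA.tgt_smooth _).mdifferentiableAt (by simp)).hasMFDerivAt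
    have h2 : ContMDiffAt (𝓡 m) (𝓡 m) ∞ (A.tgt ∘ σ) (A.tgt h₁) :=
      ContMDiffAt.comp _ (hA.tgt_smooth _) hσat
    have h3 := ((h2.mdifferentiableAt (by simp)).hasMFDerivAt.comp h₁
      ((hA.tgt_smooth h₁).mdifferentiableAt (by simp)).hasMFDerivAt).congr_of_eventuallyEq
      (f₁ := A.tgt ∘ lam) htl
    have h4 := DFunLike.congr_fun (hasMFDerivAt_unique (h1.comp h₁ hdlam) h3) v
    refine h4.trans ?_
    change mfderiv (𝓡 m) (𝓡 m) (A.tgt ∘ σ) (A.tgt h₁) (mfderiv (𝓡 n) (𝓡 m) A.tgt h₁ v) = 0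
    rw [hv, map_zero]
  have hinj : ∀ v, mfderiv (𝓡 n) (𝓡 m) A.tgt h₁ v = 0 → Dl v = 0 → v = 0 := by
    intro v hv hDv
    -- The two sections multiply to a section through the unit, and `mu ∘ lam` is left
    -- multiplication by it, with derivative the identity on vectors killed by the target.
    let ρ : M → G := fun y => A.mul (σ' (A.tgt (σ y))) (σ y)
    have htσ : Tendsto (fun y => A.tgt (σ y)) (𝓝 (A.tgt h₁)) (𝓝 (A.tgt h₂)) := by
      have := (hA.tgt_smooth.continuous.continuousAt.comp hσat.continuousAt).tendsto
      simp only [Function.comp_apply, hσc, hct] at this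
      exact this
    have evρ : ∀ᶠ y in 𝓝 (A.tgt h₁), A.src (σ' (A.tgt (σ y))) = A.tgt (σ y) :=
      htσ.eventually ev'
    have hρ : ContMDiffAt (𝓡 m) (𝓡 n) ∞ ρ (A.tgt h₁) := by
      refine hA.contMDiffAt_mul ?_ hσat evρ
      refine ContMDiffAt.comp (g := σ') (f := fun y => A.tgt (σ y)) (I' := 𝓡 m) _ ?_
        (ContMDiffAt.comp _ (hA.tgt_smooth _) hσat)
      rw [hσc, hct]
      exact hσat'
    have hρu : ρ (A.tgt h₁) = A.unit (A.tgt h₁) := by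
      simp only [ρ, hσc, hct, hσc']
      rw [A.inv_mul, hcs]
    have hρs : ∀ᶠ y in 𝓝 (A.tgt h₁), A.src (ρ y) = y := by
      filter_upwards [evρ, ev] with y h1 h2
      simp only [ρ]
      rw [A.src_mul _ _ h1, h2]
    obtain ⟨D, hD, hDv'⟩ :=
      hA.hasMFDerivAt_mul_section (hρ.mdifferentiableAt (by simp)) hρu hρs
    have hml : mu ∘ lam =ᶠ[𝓝 h₁] fun k => A.mul (ρ (A.tgt k)) k := by
      filter_upwards [(ht h₁).eventually ev, (ht h₁).eventually evρ] with k h1 h2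
      simp only [mu, lam, ρ, Function.comp_apply]
      rw [A.tgt_mul _ _ h1, A.mul_assoc _ _ _ h2 h1]
    have h1 := hasMFDerivAt_unique (hdmu.comp h₁ hdlam) (hD.congr_of_eventuallyEq hml)
    refine (hDv' v hv).symm.trans ((DFunLike.congr_fun h1 v).symm.trans ?_)
    change mfderiv (𝓡 n) (𝓡 n) mu (lam h₁) (Dl v) = 0
    rw [hDv, map_zero]
  let Dl' : EuclideanSpace ℝ (Fin n) →ₗ[ℝ] EuclideanSpace ℝ (Fin n) := Dl.toLinearMap
  have hmaps : ∀ v ∈ A.isotropyTangent n m h₁, Dl' v ∈ A.isotropyTangent n m h₂ := by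
    rintro v ⟨hv₁, hv₂⟩
    exact ⟨(hds v).trans hv₁, hdt v hv₂⟩
  refine LinearMap.finrank_le_finrank_of_injective (f := Dl'.restrict hmaps) ?_
  rw [injective_iff_map_eq_zero]
  rintro ⟨v, hv₁, hv₂⟩ hv
  exact Subtype.ext (hinj v hv₂ (congrArg Subtype.val hv))

/-- The target map has constant rank on source fibres. -/
theorem IsSmooth.finrank_range_mfderiv_tgt (hA : A.IsSmooth n m) {x : M} {d : ℕ}
    [ChartedSpace (EuclideanSpace ℝ (Fin d)) (A.SrcFibre x)]
    (hd : m + d = n) (hι : IsImmersion (𝓡 d) (𝓡 n) ∞ (Subtype.val : A.SrcFibre x → G))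
    (g : A.SrcFibre x) :
    Module.finrank ℝ (mfderiv (𝓡 d) (𝓡 m) (fun g : A.SrcFibre x => A.tgt g.1) g).range +
      Module.finrank ℝ (A.isotropyTangent n m g.1) = d := by
  let J : EuclideanSpace ℝ (Fin d) →ₗ[ℝ] EuclideanSpace ℝ (Fin n) :=
    (mfderiv (𝓡 d) (𝓡 n) (Subtype.val : A.SrcFibre x → G) g).toLinearMap
  let B : EuclideanSpace ℝ (Fin n) →ₗ[ℝ] EuclideanSpace ℝ (Fin m) :=
    (mfderiv (𝓡 n) (𝓡 m) A.tgt g.1).toLinearMap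
  let Ds : EuclideanSpace ℝ (Fin n) →ₗ[ℝ] EuclideanSpace ℝ (Fin m) :=
    (mfderiv (𝓡 n) (𝓡 m) A.src g.1).toLinearMap
  have hJ : Function.Injective J := hι.mfderiv_injective g
  have hDs : Function.Surjective Ds := hA.src_submersion.mfderiv_surjective g.1
  have hdι := ((hι.contMDiff g).mdifferentiableAt (by simp)).hasMFDerivAt
  have hDsJ : LinearMap.range J ≤ LinearMap.ker Ds := by
    rintro _ ⟨v, rfl⟩
    have h1 := ((hA.src_submersion.contMDiff g.1).mdifferentiableAt
      (by simp)).hasMFDerivAt.comp g hdι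
    have h2 : A.src ∘ (Subtype.val : A.SrcFibre x → G) = fun _ => x := funext fun g => g.2
    rw [h2] at h1
    exact DFunLike.congr_fun (hasMFDerivAt_unique h1 (hasMFDerivAt_const x g)) v
  have hrange : LinearMap.range J = LinearMap.ker Ds := by
    refine Submodule.eq_of_le_of_finrank_eq hDsJ ?_
    have h1 := LinearMap.finrank_range_of_inj hJ
    have h2 := Ds.finrank_range_add_finrank_ker
    rw [LinearMap.range_eq_top.2 hDs, finrank_top] at h2
    simp only [finrank_euclideanSpace_fin] at h1 h2
    omega
  have hτ : mfderiv (𝓡 d) (𝓡 m) (fun g : A.SrcFibre x => A.tgt g.1) g =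
      (mfderiv (𝓡 n) (𝓡 m) A.tgt g.1).comp
        (mfderiv (𝓡 d) (𝓡 n) (Subtype.val : A.SrcFibre x → G) g) :=
    (((hA.tgt_smooth g.1).mdifferentiableAt (by simp)).hasMFDerivAt.comp g hdι).mfderiv
  rw [hτ]
  change Module.finrank ℝ (LinearMap.range (B ∘ₗ J)) + _ = d
  have h1 := (B ∘ₗ J).finrank_range_add_finrank_ker
  -- The kernel of the target on the fibre is the isotropy tangent space, so rank–nullity on the
  -- fibre gives the claim.
  have h2 : A.isotropyTangent n m g.1 = (LinearMap.ker (B ∘ₗ J)).map J := by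
    rw [LinearMap.ker_comp, Submodule.map_comap_eq, hrange]
    rfl
  rw [h2, (Submodule.equivMapOfInjective J hJ _).symm.finrank_eq]
  simpa using h1

/-- The projection of a source fibre to the orbit, with the quotient topology, is open. -/
theorem IsSmooth.isOpenQuotientMap_toOrbit (hA : A.IsSmooth n m) (x : M) :
    @IsOpenQuotientMap _ _ _ (TopologicalSpace.coinduced (A.toOrbit x) inferInstance)
      (A.toOrbit x) := by
  let : TopologicalSpace (Bare (A.orbit x)) :=
    TopologicalSpace.coinduced (A.toOrbit x) inferInstance
  refine ⟨A.toOrbit_surjective x, continuous_coinduced_rng, fun U hU => ?_⟩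
  change IsOpen (A.toOrbit x ⁻¹' (A.toOrbit x '' U))
  rw [isOpen_iff_mem_nhds]
  rintro ⟨g, hg⟩ ⟨⟨g', hg'⟩, hgU, he⟩
  replace he : A.tgt g' = A.tgt g := congrArg Bare.val he
  have hgk : A.src (A.inv g) = A.tgt g' := by rw [A.src_inv, he]
  -- The isotropy arrow g⁻¹g' acts on the source fibre by right translation, which preserves targets
  -- and takes `g` to `g'`; the preimage of `U` is the neighbourhood of `g` sought.
  set k := A.mul (A.inv g) g' with hk
  have hks : A.src k = x := (A.src_mul _ _ hgk).trans hg'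
  have hkt : A.tgt k = x := (A.tgt_mul _ _ hgk).trans ((A.tgt_inv _).trans hg)
  have hcomp : ∀ h : A.SrcFibre x, A.src h.1 = A.tgt k := fun h => h.2.trans hkt.symm
  let R : A.SrcFibre x → A.SrcFibre x :=
    fun h => ⟨A.mul h.1 k, (A.src_mul _ _ (hcomp h)).trans hks⟩
  have hR : Continuous R := by
    refine Continuous.subtype_mk ?_ _
    exact hA.mul_continuousOn.comp_continuous (continuous_subtype_val.prodMk continuous_const) hcomp
  refine mem_of_superset ((hU.preimage hR).mem_nhds ?_) ?_
  · have h1 : A.mul g k = g' := by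
      rw [hk, ← A.mul_assoc _ _ _ (A.tgt_inv _).symm hgk, A.mul_inv, ← he, A.unit_mul]
    have h2 : R ⟨g, hg⟩ = ⟨g', hg'⟩ := Subtype.ext h1
    rw [mem_preimage, h2]
    exact hgU
  · intro h hh
    exact ⟨R h, hh, Bare.ext (A.tgt_mul _ _ (hcomp h))⟩

/-- The orbits of a smooth groupoid are immersed submanifolds. -/
theorem IsSmooth.exists_isOrbitStructure (hA : A.IsSmooth n m) (x : M) :
    ∃ (k : ℕ) (_ : TopologicalSpace (Bare (A.orbit x)))
      (_ : ChartedSpace (EuclideanSpace ℝ (Fin k)) (Bare (A.orbit x))),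
      IsManifold (𝓡 k) ∞ (Bare (A.orbit x)) ∧ A.IsOrbitStructure n m x k ∧
        IsOpenQuotientMap (A.toOrbit x) := by
  obtain ⟨d, cs, hdn, hman, hemb⟩ :=
    hA.src_submersion.exists_chartedSpace_fibre ⟨A.unit x, A.src_unit x⟩
  have hq := hA.isOpenQuotientMap_toOrbit x
  let top : TopologicalSpace (Bare (A.orbit x)) :=
    TopologicalSpace.coinduced (A.toOrbit x) inferInstance
  let q := A.toOrbit x
  let τ : A.SrcFibre x → M := fun g => A.tgt g.1
  have hτ : ContMDiff (𝓡 d) (𝓡 m) ∞ τ := hA.tgt_smooth.comp hemb.contMDiff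
  let g₀ : A.SrcFibre x := ⟨A.unit x, A.src_unit x⟩
  let r := Module.finrank ℝ (mfderiv (𝓡 d) (𝓡 m) τ g₀).range
  have hrk : ∀ g, Module.finrank ℝ (mfderiv (𝓡 d) (𝓡 m) τ g).range = r := by
    intro g
    have h1 := hA.finrank_range_mfderiv_tgt hdn hemb.isImmersion g
    have h2 := hA.finrank_range_mfderiv_tgt hdn hemb.isImmersion g₀
    have h3 := hA.finrank_isotropyTangent_le (h₁ := g.1) (h₂ := g₀.1) (g.2.trans g₀.2.symm)
    have h4 := hA.finrank_isotropyTangent_le (h₁ := g₀.1) (h₂ := g.1) (g₀.2.trans g.2.symm)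
    change _ = Module.finrank ℝ (mfderiv (𝓡 d) (𝓡 m) τ g₀).range
    simp only [τ]
    omega
  have hrd : r ≤ d := by
    have := hA.finrank_range_mfderiv_tgt hdn hemb.isImmersion g₀
    change r + _ = d at this
    omega
  have hrm : r ≤ m := by
    have h : r ≤ Module.finrank ℝ (EuclideanSpace ℝ (Fin m)) :=
      Submodule.finrank_le (R := ℝ) (M := EuclideanSpace ℝ (Fin m)) _
    simpa using h
  let K := EuclideanSpace ℝ (Fin (d - r))
  let C := EuclideanSpace ℝ (Fin (m - r))
  have hval : Continuous (Bare.val : Bare (A.orbit x) → M) :=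
    (hq.continuous_comp_iff).1 hτ.continuous
  have hchart : ∀ g : A.SrcFibre x,
      ∃ e ∈ sliceCharts (E' := EuclideanSpace ℝ (Fin m)) (EuclideanSpace ℝ (Fin r)) C
        (Bare.val : Bare (A.orbit x) → M), ∃ φ ∈ maximalAtlas (𝓡 d) ∞ (A.SrcFibre x),
      ∃ L : EuclideanSpace ℝ (Fin d) ≃L[ℝ] EuclideanSpace ℝ (Fin r) × K,
        g ∈ φ.source ∧ MapsTo q φ.source e.source ∧ ∀ h ∈ φ.source, e (q h) = (L (φ h)).1 := by
    intro g
    obtain ⟨φ, hφ, ψ, hψ, L, L', hg, hm, hn⟩ := exists_constant_rank_charts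
      (A := EuclideanSpace ℝ (Fin r)) (K := K) (C := C) hτ (fun g => by simpa using hrk g)
      (by simp [K, hrd]) (by simp [C, hrm]) g
    -- On this chart `τ`, and with it the point of the orbit, is determined by the first coordinate;
    -- hence that coordinate is a chart on the image, which is open because `q` is.
    have hback : ∀ h ∈ φ.source, ψ.symm (L' ((L (φ h)).1, 0)) = τ h := by
      intro h hh
      rw [← hn h hh, ψ.left_inv (hm hh)]
    classical
    let inv : EuclideanSpace ℝ (Fin r) → Bare (A.orbit x) := fun a =>
      if h : ψ.symm (L' (a, 0)) ∈ A.orbit x then Bare.mk _ h else q g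
    have hinv : ∀ h ∈ φ.source, inv (L (φ h)).1 = q h := by
      intro h hh
      have h1 : ψ.symm (L' ((L (φ h)).1, 0)) ∈ A.orbit x := by
        rw [hback h hh]
        exact (q h).val_mem
      simp only [inv]
      rw [dif_pos h1]
      exact Bare.ext (hback h hh)
    have hfun : ∀ h ∈ φ.source, (L'.symm (ψ (q h).val)).1 = (L (φ h)).1 := by
      intro h hh
      have h1 : ψ (q h).val = L' ((L (φ h)).1, 0) := hn h hh
      rw [h1, L'.symm_apply_apply]
    let e : OpenPartialHomeomorph (Bare (A.orbit x)) (EuclideanSpace ℝ (Fin r)) :=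
      { toFun := fun y => (L'.symm (ψ y.val)).1
        invFun := inv
        source := q '' φ.source
        target := (fun v => (L v).1) '' φ.target
        map_source' := by
          rintro _ ⟨h, hh, rfl⟩
          exact ⟨φ h, φ.map_source hh, (hfun h hh).symm⟩
        map_target' := by
          rintro _ ⟨v, hv, rfl⟩
          have h1 := hinv _ (φ.map_target hv)
          rw [φ.right_inv hv] at h1
          exact ⟨_, φ.map_target hv, h1.symm⟩
        left_inv' := by
          rintro _ ⟨h, hh, rfl⟩
          rw [hfun h hh, hinv h hh]
        right_inv' := by
          rintro _ ⟨v, hv, rfl⟩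
          have h1 := hinv _ (φ.map_target hv)
          have h2 := hfun _ (φ.map_target hv)
          rw [φ.right_inv hv] at h1 h2
          simp only
          rw [h1, h2]
        open_source := hq.isOpenMap _ φ.open_source
        open_target := (isOpenMap_fst.comp L.toHomeomorph.isOpenMap) _ φ.open_target
        continuousOn_toFun := by
          refine Continuous.comp_continuousOn (g := fun a => (L'.symm a).1) (by fun_prop) ?_
          refine ψ.continuousOn.comp hval.continuousOn ?_
          rintro _ ⟨h, hh, rfl⟩
          exact hm hh
        continuousOn_invFun := by
          rintro _ ⟨v, hv, rfl⟩
          refine ContinuousAt.continuousWithinAt ?_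
          -- Fixing the remaining coordinates lifts the inverse chart continuously to the source
          -- fibre.
          let j : EuclideanSpace ℝ (Fin r) → EuclideanSpace ℝ (Fin d) :=
            fun a => L.symm (a, (L v).2)
          have hj : Continuous j := by fun_prop
          have hjv : j (L v).1 = v := by simp [j]
          have h1 : ContinuousAt (fun a => q (φ.symm (j a))) (L v).1 := by
            refine hq.continuous.continuousAt.comp (ContinuousAt.comp (g := φ.symm) ?_
              hj.continuousAt)
            rw [hjv]
            exact φ.continuousAt_symm hv
          refine h1.congr ?_
          have h2 : ∀ᶠ a in 𝓝 (L v).1, j a ∈ φ.target :=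
            hj.continuousAt.eventually (by rw [hjv]; exact φ.open_target.mem_nhds hv)
          filter_upwards [h2] with a ha
          have h3 := hinv _ (φ.map_target ha)
          rw [φ.right_inv ha] at h3
          simp only [j, L.apply_symm_apply] at h3
          exact h3.symm }
    refine ⟨e, ⟨ψ, hψ, L', ?_, ?_⟩, φ, hφ, L, hg, fun h hh => ⟨h, hh, rfl⟩, hfun⟩
    · rintro _ ⟨h, hh, rfl⟩
      exact hm hh
    · rintro _ ⟨h, hh, rfl⟩
      change ψ (q h).val = L' ((L'.symm (ψ (q h).val)).1, 0)
      rw [hfun h hh]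
      exact hn h hh
  obtain ⟨csO, hmanO, himm, hmax⟩ := exists_chartedSpace_of_sliceCharts
    (E' := EuclideanSpace ℝ (Fin m)) (A := EuclideanSpace ℝ (Fin r)) (C := C)
    (ι := (Bare.val : Bare (A.orbit x) → M)) (by
      intro y
      obtain ⟨g, rfl⟩ := A.toOrbit_surjective x y
      obtain ⟨e, he, φ, hφ, L, hg, hm, -⟩ := hchart g
      exact ⟨e, he, hm hg⟩)
  refine ⟨r, top, csO, hmanO, ⟨himm, d, cs, hman, hemb, ?_⟩, hq⟩
  refine IsSubmersionOfComplement.isSubmersion (F := K) fun g => ?_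
  obtain ⟨e, he, φ, hφ, L, hg, hm, hn⟩ := hchart g
  refine IsSubmersionAtOfComplement.mk_of_charts L φ e hg (hm hg) hφ (hmax he) hm ?_
  intro v hv
  have hv' : v ∈ φ.target := by simpa only [mfld_simps] using hv
  have h1 := hn _ (φ.map_target hv')
  rw [φ.right_inv hv'] at h1
  simpa only [mfld_simps, Function.comp_apply] using h1

end Grpd

/-! ### Orbits of double Lie groupoids -/

section DoubleGroupoids

open Set Filter Topology

/-- An open quotient map stays one over any subset of its target, open or not; it is needed for the
set of composable pairs. -/
theorem IsOpenQuotientMap.continuousOn_of_comp {X Y Z : Type*} [TopologicalSpace X]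
    [TopologicalSpace Y] [TopologicalSpace Z] {Q : X → Y} (hQ : IsOpenQuotientMap Q) {f : Y → Z}
    {P : Set Y} (h : Continuous fun x : Q ⁻¹' P => f (Q x.1)) : ContinuousOn f P := by
  rw [continuousOn_iff_continuous_domRestrict]
  exact (hQ.restrictPreimage P).continuous_comp_iff.1 h

namespace Grpd

theorem inv_unit {G : Type u} {M : Type v} (A : Grpd G M) (x : M) :
    A.inv (A.unit x) = A.unit x := by
  have h1 := A.mul_unit (A.inv (A.unit x))
  have h2 := A.inv_mul (A.unit x)
  rw [A.src_inv, A.tgt_unit] at h1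
  rw [A.src_unit] at h2
  exact h1.symm.trans h2

theorem unit_mul_unit {G : Type u} {M : Type v} (A : Grpd G M) (x : M) :
    A.mul (A.unit x) (A.unit x) = A.unit x := by
  have h1 := A.unit_mul (A.unit x)
  rwa [A.tgt_unit] at h1

theorem IsSmooth.continuous_mul {G : Type u} {M : Type v} {n m : ℕ}
    [TopologicalSpace G] [ChartedSpace (EuclideanSpace ℝ (Fin n)) G] [IsManifold (𝓡 n) ∞ G]
    [TopologicalSpace M] [ChartedSpace (EuclideanSpace ℝ (Fin m)) M] [IsManifold (𝓡 m) ∞ M]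
    {A : Grpd G M} (hA : A.IsSmooth n m) {X : Type*} [TopologicalSpace X] {a b : X → G}
    (ha : Continuous a) (hb : Continuous b) (hab : ∀ x, A.src (a x) = A.tgt (b x)) :
    Continuous fun x => A.mul (a x) (b x) :=
  hA.mul_continuousOn.comp_continuous (ha.prodMk hb) hab

end Grpd

/-! ### Representing orbit operations by vertical operations -/

namespace IsDoubleGroupoid

variable {G₁ M₁ G₀ M₀ : Type*} {H : Grpd G₁ M₁} {V : Grpd G₁ G₀} {S : Grpd M₁ M₀}
  {T : Grpd G₀ M₀} {u : M₀}

theorem src_vsrc (hD : IsDoubleGroupoid H V S T) {g : G₁} (hg : H.src g = S.unit u) :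
    T.src (V.src g) = u := by
  rw [hD.src_hom.map_src, hg, S.src_unit]

theorem src_vtgt (hD : IsDoubleGroupoid H V S T) {g : G₁} (hg : H.src g = S.unit u) :
    T.src (V.tgt g) = u := by
  rw [hD.tgt_hom.map_src, hg, S.tgt_unit]

theorem src_vinv (hD : IsDoubleGroupoid H V S T) {g : G₁} (hg : H.src g = S.unit u) :
    H.src (V.inv g) = S.unit u := by
  rw [hD.inv_hom.map_src, hg, S.inv_unit]

theorem src_vunit (hD : IsDoubleGroupoid H V S T) {k : G₀} (hk : T.src k = u) :
    H.src (V.unit k) = S.unit u := by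
  rw [hD.unit_hom.map_src, hk]

/-- The isotropy arrow at `u` by which the vertical source of `g` and the vertical target of `h`
differ. -/
def defect (V : Grpd G₁ G₀) (T : Grpd G₀ M₀) (g h : G₁) : G₀ := T.mul (T.inv (V.tgt h)) (V.src g)

/-- A vertical product of `g` with `h`, after moving `h` by an isotropy arrow to a vertically
composable arrow. -/
def adjustedMul (H : Grpd G₁ M₁) (V : Grpd G₁ G₀) (T : Grpd G₀ M₀) (g h : G₁) : G₁ :=
  V.mul g (H.mul h (V.unit (defect V T g h)))

variable {g h : G₁}

theorem defect_composable (hD : IsDoubleGroupoid H V S T)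
    (hgh : S.src (H.tgt g) = S.tgt (H.tgt h)) :
    T.src (T.inv (V.tgt h)) = T.tgt (V.src g) := by
  rw [T.src_inv, hD.tgt_hom.map_tgt, hD.src_hom.map_tgt, hgh]

theorem adjusted_composable (hD : IsDoubleGroupoid H V S T) (hh : H.src h = S.unit u)
    (hgh : S.src (H.tgt g) = S.tgt (H.tgt h)) :
    H.src h = H.tgt (V.unit (defect V T g h)) := by
  rw [hD.unit_hom.map_tgt, defect, T.tgt_mul _ _ (hD.defect_composable hgh), T.tgt_inv,
    hD.src_vtgt hh, hh]

/-- `V.tgt` is a morphism, so the adjusted arrow has vertical target t(h)·t(h)⁻¹·s(g) = s(g), with s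
and t those of `V`. -/
theorem vsrc_eq_vtgt_adjusted (hD : IsDoubleGroupoid H V S T) (hh : H.src h = S.unit u)
    (hgh : S.src (H.tgt g) = S.tgt (H.tgt h)) :
    V.src g = V.tgt (H.mul h (V.unit (defect V T g h))) := by
  have h1 := hD.defect_composable hgh
  rw [hD.tgt_hom.map_mul _ _ (hD.adjusted_composable hh hgh), V.tgt_unit, defect,
    ← T.mul_assoc _ _ _ (T.tgt_inv _).symm h1, T.mul_inv, ← T.src_inv, h1, T.unit_mul]

theorem src_adjustedMul (hD : IsDoubleGroupoid H V S T) (hg : H.src g = S.unit u)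
    (hh : H.src h = S.unit u) (hgh : S.src (H.tgt g) = S.tgt (H.tgt h)) :
    H.src (adjustedMul H V T g h) = S.unit u := by
  rw [adjustedMul, hD.src_mul _ _ (hD.vsrc_eq_vtgt_adjusted hh hgh),
    H.src_mul _ _ (hD.adjusted_composable hh hgh), hg, hD.src_vunit (u := u), S.unit_mul_unit]
  rw [defect, T.src_mul _ _ (hD.defect_composable hgh), hD.src_vsrc hg]

/-- Horizontal multiplication on the right leaves the horizontal target of `h` alone, so the
correction does not change the point it represents. -/
theorem tgt_adjustedMul (hD : IsDoubleGroupoid H V S T)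
    (hh : H.src h = S.unit u) (hgh : S.src (H.tgt g) = S.tgt (H.tgt h)) :
    H.tgt (adjustedMul H V T g h) = S.mul (H.tgt g) (H.tgt h) := by
  rw [adjustedMul, hD.tgt_mul _ _ (hD.vsrc_eq_vtgt_adjusted hh hgh),
    H.tgt_mul _ _ (hD.adjusted_composable hh hgh)]

/-- The orbit of a unit `1_u` is a subgroupoid over the orbit of `u`. -/
theorem isSubgroupoid_orbit (hD : IsDoubleGroupoid H V S T) (u : M₀) :
    S.IsSubgroupoid (H.orbit (S.unit u)) (T.orbit u) where
  src_mem := by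
    rintro _ ⟨g, hg, rfl⟩
    exact ⟨V.src g, hD.src_vsrc hg, hD.src_hom.map_tgt g⟩
  tgt_mem := by
    rintro _ ⟨g, hg, rfl⟩
    exact ⟨V.tgt g, hD.src_vtgt hg, hD.tgt_hom.map_tgt g⟩
  unit_mem := by
    rintro _ ⟨k, hk, rfl⟩
    exact ⟨V.unit k, hD.src_vunit hk, hD.unit_hom.map_tgt k⟩
  inv_mem := by
    rintro _ ⟨g, hg, rfl⟩
    exact ⟨V.inv g, hD.src_vinv hg, hD.inv_hom.map_tgt g⟩
  mul_mem := by
    rintro _ ⟨g, hg, rfl⟩ _ ⟨h, hh, rfl⟩ hgh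
    exact ⟨_, hD.src_adjustedMul hg hh hgh, hD.tgt_adjustedMul hh hgh⟩

end IsDoubleGroupoid

/-! ### Smoothness of the groupoid on the orbits -/

namespace IsDoubleLieGroupoid

variable {G₁ M₁ G₀ M₀ : Type*} {n₁ m₁ n₀ m₀ : ℕ}
    [TopologicalSpace G₁] [ChartedSpace (EuclideanSpace ℝ (Fin n₁)) G₁] [IsManifold (𝓡 n₁) ∞ G₁]
    [TopologicalSpace M₁] [ChartedSpace (EuclideanSpace ℝ (Fin m₁)) M₁] [IsManifold (𝓡 m₁) ∞ M₁]
    [TopologicalSpace G₀] [ChartedSpace (EuclideanSpace ℝ (Fin n₀)) G₀] [IsManifold (𝓡 n₀) ∞ G₀]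
    [TopologicalSpace M₀] [ChartedSpace (EuclideanSpace ℝ (Fin m₀)) M₀] [IsManifold (𝓡 m₀) ∞ M₀]
    {H : Grpd G₁ M₁} {V : Grpd G₁ G₀} {S : Grpd M₁ M₀} {T : Grpd G₀ M₀}

/-- The vertical source, restricted to source fibres of the horizontal groupoids, has smooth local
sections. -/
theorem exists_section_fibre (hG : IsDoubleLieGroupoid n₁ m₁ n₀ m₀ H V S T) {u : M₀} {d₁ d₀ : ℕ}
    [ChartedSpace (EuclideanSpace ℝ (Fin d₁)) (H.SrcFibre (S.unit u))]
    [ChartedSpace (EuclideanSpace ℝ (Fin d₀)) (T.SrcFibre u)]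
    (h₁ : IsSmoothEmbedding (𝓡 d₁) (𝓡 n₁) ∞ (Subtype.val : H.SrcFibre (S.unit u) → G₁))
    (h₀ : IsSmoothEmbedding (𝓡 d₀) (𝓡 n₀) ∞ (Subtype.val : T.SrcFibre u → G₀))
    (g : H.SrcFibre (S.unit u)) (f : T.SrcFibre u) (hgf : V.src g.1 = f.1) :
    ∃ β : T.SrcFibre u → H.SrcFibre (S.unit u), ContMDiffAt (𝓡 d₀) (𝓡 d₁) ∞ β f ∧ β f = g ∧
      ∀ᶠ k in 𝓝 f, V.src (β k).1 = k.1 := by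
  obtain ⟨d, cs, hman, hemb, hsub⟩ := hG.doubleSrc_submersion
  obtain ⟨σ, W, hW, hgW, hσ, hσg, hσs⟩ := hsub.exists_section g.1
  -- On the slice {1_u} × F₀ a section of the double source automatically takes values in the
  -- horizontal source fibre over 1_u.
  let j : T.SrcFibre u → SrcPairs S T :=
    fun k => ⟨(S.unit u, k.1), (S.src_unit u).trans k.2.symm⟩
  have hj : ContMDiff (𝓡 d₀) (𝓡 d) ∞ j := by
    rw [ContMDiff.iff_comp_isImmersion hemb.isImmersion]
    exact ⟨(continuous_const.prodMk continuous_subtype_val).subtype_mk _,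
      contMDiff_const.prodMk h₀.contMDiff⟩
  have hjf : j f = hG.double.doubleSrc g.1 := Subtype.ext (Prod.ext g.2.symm hgf.symm)
  have hev : ∀ᶠ k in 𝓝 f, j k ∈ W :=
    hj.continuous.continuousAt.eventually (by rw [hjf]; exact hW.mem_nhds hgW)
  classical
  let β : T.SrcFibre u → H.SrcFibre (S.unit u) :=
    fun k => if hk : H.src (σ (j k)) = S.unit u then ⟨σ (j k), hk⟩ else g
  have hβ : ∀ k, j k ∈ W → (β k).1 = σ (j k) := by
    intro k hk
    have h1 : H.src (σ (j k)) = S.unit u := congrArg (fun p => p.1.1) (hσs _ hk)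
    simp only [β]
    rw [dif_pos h1]
  have hβev : (Subtype.val ∘ β) =ᶠ[𝓝 f] σ ∘ j := by
    filter_upwards [hev] with k hk using hβ k hk
  have hs : ContMDiffAt (𝓡 d₀) (𝓡 n₁) ∞ (Subtype.val ∘ β) f := by
    refine ContMDiffAt.congr_of_eventuallyEq (ContMDiffAt.comp f ?_ (hj f)) hβev
    rw [hjf]
    exact hσ.contMDiffAt (hW.mem_nhds hgW)
  refine ⟨β, ?_, ?_, ?_⟩
  · rw [← contMDiffWithinAt_univ]
    refine h₁.isImmersion.contMDiffWithinAt_of_comp (mem_univ f) ?_ hs.contMDiffWithinAt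
    rw [continuousWithinAt_univ]
    exact h₁.isEmbedding.isInducing.continuousAt_iff.2 hs.continuousAt
  · refine Subtype.ext ?_
    rw [hβ f hev.self_of_nhds, hjf, hσg]
  · filter_upwards [hev] with k hk
    rw [hβ k hk]
    exact congrArg (fun p => p.1.2) (hσs _ hk)

/-- With the orbit structures, the orbit of `1_u` is a smooth groupoid over the orbit of `u`. -/
theorem isSmooth_restrict_orbit (hG : IsDoubleLieGroupoid n₁ m₁ n₀ m₀ H V S T) {u : M₀}
    {k₁ k₀ : ℕ} [TopologicalSpace (Bare (H.orbit (S.unit u)))]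
    [ChartedSpace (EuclideanSpace ℝ (Fin k₁)) (Bare (H.orbit (S.unit u)))]
    [IsManifold (𝓡 k₁) ∞ (Bare (H.orbit (S.unit u)))]
    [TopologicalSpace (Bare (T.orbit u))]
    [ChartedSpace (EuclideanSpace ℝ (Fin k₀)) (Bare (T.orbit u))]
    [IsManifold (𝓡 k₀) ∞ (Bare (T.orbit u))]
    (hO₁ : H.IsOrbitStructure n₁ m₁ (S.unit u) k₁) (hO₀ : T.IsOrbitStructure n₀ m₀ u k₀)
    (hq₁ : IsOpenQuotientMap (H.toOrbit (S.unit u))) (hq₀ : IsOpenQuotientMap (T.toOrbit u)) :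
    (hG.double.isSubgroupoid_orbit u).restrict.IsSmooth k₁ k₀ := by
  have hD := hG.double
  have hV := hG.smooth_V
  have hS := hG.lie_S.toIsSmooth
  set R := (hG.double.isSubgroupoid_orbit u).restrict
  let q₁ := H.toOrbit (S.unit u)
  let q₀ := T.toOrbit u
  -- lifts of the structure maps to the source fibres
  let vs : H.SrcFibre (S.unit u) → T.SrcFibre u := fun g => ⟨V.src g.1, hD.src_vsrc g.2⟩
  let vt : H.SrcFibre (S.unit u) → T.SrcFibre u := fun g => ⟨V.tgt g.1, hD.src_vtgt g.2⟩
  let vu : T.SrcFibre u → H.SrcFibre (S.unit u) := fun k => ⟨V.unit k.1, hD.src_vunit k.2⟩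
  let vi : H.SrcFibre (S.unit u) → H.SrcFibre (S.unit u) := fun g => ⟨V.inv g.1, hD.src_vinv g.2⟩
  have hvs : Continuous vs :=
    (hV.src_submersion.contMDiff.continuous.comp continuous_subtype_val).subtype_mk _
  have hvt : Continuous vt := (hV.tgt_smooth.continuous.comp continuous_subtype_val).subtype_mk _
  have hvu : Continuous vu := (hV.unit_smooth.continuous.comp continuous_subtype_val).subtype_mk _
  have hvi : Continuous vi := (hV.inv_smooth.continuous.comp continuous_subtype_val).subtype_mk _
  have es : R.src ∘ q₁ = q₀ ∘ vs := funext fun g => Bare.ext (hD.src_hom.map_tgt g.1).symm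
  have et : R.tgt ∘ q₁ = q₀ ∘ vt := funext fun g => Bare.ext (hD.tgt_hom.map_tgt g.1).symm
  have eu : R.unit ∘ q₀ = q₁ ∘ vu := funext fun g => Bare.ext (hD.unit_hom.map_tgt g.1).symm
  have ei : R.inv ∘ q₁ = q₁ ∘ vi := funext fun g => Bare.ext (hD.inv_hom.map_tgt g.1).symm
  have cs : Continuous R.src := hq₁.continuous_comp_iff.1 (by
    change Continuous (R.src ∘ q₁); rw [es]; exact hq₀.continuous.comp hvs)
  have ct : Continuous R.tgt := hq₁.continuous_comp_iff.1 (by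
    change Continuous (R.tgt ∘ q₁); rw [et]; exact hq₀.continuous.comp hvt)
  have cu : Continuous R.unit := hq₀.continuous_comp_iff.1 (by
    change Continuous (R.unit ∘ q₀); rw [eu]; exact hq₁.continuous.comp hvu)
  have ci : Continuous R.inv := hq₁.continuous_comp_iff.1 (by
    change Continuous (R.inv ∘ q₁); rw [ei]; exact hq₁.continuous.comp hvi)
  have hι₁ := hO₁.immersion.contMDiff
  have hι₀ := hO₀.immersion.contMDiff
  have hsrc : ContMDiff (𝓡 k₁) (𝓡 k₀) ∞ R.src :=
    (ContMDiff.iff_comp_isImmersion hO₀.immersion).2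
      ⟨cs, hS.src_submersion.contMDiff.comp hι₁⟩
  refine ⟨?_, (ContMDiff.iff_comp_isImmersion hO₀.immersion).2 ⟨ct, hS.tgt_smooth.comp hι₁⟩,
    (ContMDiff.iff_comp_isImmersion hO₁.immersion).2 ⟨cu, hS.unit_smooth.comp hι₀⟩,
    (ContMDiff.iff_comp_isImmersion hO₁.immersion).2 ⟨ci, hS.inv_smooth.comp hι₁⟩, ?_⟩
  · obtain ⟨d₁, csF₁, hmF₁, hF₁, hs₁⟩ := hO₁.submersion
    obtain ⟨d₀, csF₀, hmF₀, hF₀, hs₀⟩ := hO₀.submersion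
    refine isSubmersion_of_sections hsrc fun y => ?_
    obtain ⟨g, rfl⟩ := hq₁.surjective y
    obtain ⟨β, hβ, hβg, hβs⟩ := hG.exists_section_fibre hF₁ hF₀ g (vs g) rfl
    obtain ⟨τ, W, hW, hyW, hτ, hτy, hτs⟩ := hs₀.exists_section (vs g)
    have hy : R.src (H.toOrbit (S.unit u) g) = T.toOrbit u (vs g) := congrFun es g
    rw [hy]
    have hτ' := hτ.contMDiffAt (hW.mem_nhds hyW)
    -- A point of the base orbit is lifted to F₀, then to F₁ along the vertical source, and
    -- projected to the orbit of 1_u.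
    refine ⟨q₁ ∘ β ∘ τ, ?_, ?_, ?_⟩
    · refine hs₁.contMDiff.contMDiffAt.comp _ (ContMDiffAt.comp _ ?_ hτ')
      rw [hτy]
      exact hβ
    · simp only [Function.comp_apply]
      rw [hτy, hβg]
    · have h1 : ∀ᶠ z in 𝓝 (T.toOrbit u (vs g)), V.src (β (τ z)).1 = (τ z).1 := by
        have h2 := hτ'.continuousAt.tendsto
        rw [hτy] at h2
        exact h2.eventually hβs
      filter_upwards [h1, hW.mem_nhds hyW] with z hz hzW
      have h2 : R.src (q₁ (β (τ z))) = q₀ (vs (β (τ z))) := congrFun es _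
      have h3 : vs (β (τ z)) = τ z := Subtype.ext hz
      rw [h3] at h2
      exact h2.trans (hτs z hzW)
  · let P : Set (Bare (H.orbit (S.unit u)) × Bare (H.orbit (S.unit u))) :=
      {p | R.src p.1 = R.tgt p.2}
    have hP : ∀ p ∈ P, (R.mul p.1 p.2).val = S.mul p.1.val p.2.val := fun p hp =>
      congrArg Bare.val (dif_pos (congrArg Bare.val hp))
    have hPS : ∀ p ∈ P, S.src p.1.val = S.tgt p.2.val := fun p hp => congrArg Bare.val hp
    have hcont : ContinuousOn (fun p : _ × _ => R.mul p.1 p.2) P := by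
      -- Openness matters here: products of open quotient maps are again open quotient maps, so
      -- continuity can be tested on pairs of representatives.
      refine (hq₁.prodMap hq₁).continuousOn_of_comp ?_
      let X := Prod.map (H.toOrbit (S.unit u)) (H.toOrbit (S.unit u)) ⁻¹' P
      have hX : ∀ x : X, S.src (H.tgt x.1.1.1) = S.tgt (H.tgt x.1.2.1) := fun x => hPS _ x.2
      have c₁ : Continuous fun x : X => x.1.1.1 := by fun_prop
      have c₂ : Continuous fun x : X => x.1.2.1 := by fun_prop
      have c₃ : Continuous fun x : X => IsDoubleGroupoid.adjustedMul H V T x.1.1.1 x.1.2.1 := by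
        refine hV.continuous_mul c₁ (hG.smooth_H.continuous_mul c₂
          (hV.unit_smooth.continuous.comp (hG.lie_T.toIsSmooth.continuous_mul
            (hG.lie_T.inv_smooth.continuous.comp (hV.tgt_smooth.continuous.comp c₂))
            (hV.src_submersion.contMDiff.continuous.comp c₁) ?_)) ?_) ?_
        · exact fun x => hD.defect_composable (hX x)
        · exact fun x => hD.adjusted_composable x.1.2.2 (hX x)
        · exact fun x => hD.vsrc_eq_vtgt_adjusted x.1.2.2 (hX x)
      have c₄ : Continuous fun x : X => q₁ ⟨_, hD.src_adjustedMul x.1.1.2 x.1.2.2 (hX x)⟩ :=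
        hq₁.continuous.comp (c₃.subtype_mk _)
      refine c₄.congr fun x => Bare.ext ?_
      exact (hD.tgt_adjustedMul x.1.2.2 (hX x)).trans (hP _ x.2).symm
    intro p hp
    refine hO₁.immersion.contMDiffWithinAt_of_comp hp (hcont p hp) ?_
    have h1 : ContMDiffWithinAt ((𝓡 k₁).prod (𝓡 k₁)) ((𝓡 m₁).prod (𝓡 m₁)) ∞
        (Prod.map Bare.val Bare.val : _ × _ → M₁ × M₁) P p :=
      (hι₁.prodMap hι₁).contMDiffAt.contMDiffWithinAt
    refine (ContMDiffWithinAt.comp p (hS.mul_smooth _ (hPS p hp)) h1 hPS).congr ?_ ?_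
    · exact fun z hz => hP z hz
    · exact hP p hp

end IsDoubleLieGroupoid

end DoubleGroupoids

theorem proposition3p3 {G₁ M₁ G₀ M₀ : Type*} (n₁ m₁ n₀ m₀ : ℕ)
    [TopologicalSpace G₁] [ChartedSpace (EuclideanSpace ℝ (Fin n₁)) G₁] [IsManifold (𝓡 n₁) ∞ G₁]
    [TopologicalSpace M₁] [ChartedSpace (EuclideanSpace ℝ (Fin m₁)) M₁] [IsManifold (𝓡 m₁) ∞ M₁]
    [TopologicalSpace G₀] [ChartedSpace (EuclideanSpace ℝ (Fin n₀)) G₀] [IsManifold (𝓡 n₀) ∞ G₀]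
    [TopologicalSpace M₀] [ChartedSpace (EuclideanSpace ℝ (Fin m₀)) M₀] [IsManifold (𝓡 m₀) ∞ M₀]
    (H : Grpd G₁ M₁) (V : Grpd G₁ G₀) (S : Grpd M₁ M₀) (T : Grpd G₀ M₀)
    (hG : IsDoubleLieGroupoid n₁ m₁ n₀ m₀ H V S T) (u : M₀) :
    ∃ (hsub : S.IsSubgroupoid (H.orbit (S.unit u)) (T.orbit u))
      (k₁ k₀ : ℕ)
      (_ : TopologicalSpace (Bare (H.orbit (S.unit u))))
      (_ : ChartedSpace (EuclideanSpace ℝ (Fin k₁)) (Bare (H.orbit (S.unit u))))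
      (_ : IsManifold (𝓡 k₁) ∞ (Bare (H.orbit (S.unit u))))
      (_ : TopologicalSpace (Bare (T.orbit u)))
      (_ : ChartedSpace (EuclideanSpace ℝ (Fin k₀)) (Bare (T.orbit u)))
      (_ : IsManifold (𝓡 k₀) ∞ (Bare (T.orbit u))),
      H.IsOrbitStructure n₁ m₁ (S.unit u) k₁ ∧
      T.IsOrbitStructure n₀ m₀ u k₀ ∧
      hsub.restrict.IsSmooth k₁ k₀ ∧
      (SecondCountableTopology G₁ → SecondCountableTopology (Bare (H.orbit (S.unit u)))) ∧
      (SecondCountableTopology G₀ → SecondCountableTopology (Bare (T.orbit u))) := by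
  obtain ⟨k₁, t₁, c₁, hm₁, hO₁, hq₁⟩ := hG.smooth_H.exists_isOrbitStructure (S.unit u)
  obtain ⟨k₀, t₀, c₀, hm₀, hO₀, hq₀⟩ := hG.lie_T.toIsSmooth.exists_isOrbitStructure u
  refine ⟨hG.double.isSubgroupoid_orbit u, k₁, k₀, t₁, c₁, hm₁, t₀, c₀, hm₀, hO₁, hO₀,
    hG.isSmooth_restrict_orbit hO₁ hO₀ hq₁ hq₀,
    fun _ => ?_, fun _ => ?_⟩
  -- The source fibre inherits second countability as a subspace, and an open quotient map passes it
  -- on to the orbit.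
  · have := Topology.IsInducing.subtypeVal.secondCountableTopology (α := H.SrcFibre (S.unit u))
    exact hq₁.isQuotientMap.secondCountableTopology hq₁.isOpenMap
  · have := Topology.IsInducing.subtypeVal.secondCountableTopology (α := T.SrcFibre u)
    exact hq₀.isQuotientMap.secondCountableTopology hq₀.isOpenMap
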